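/- All graphs are simple, and $d_G(v,w)\in\{0,1,2,\dots\}\cup\{\infty\}$ denotes the graph distance in $G$ (with $d_G(v,w)=\infty$ if $v$ and $w$ lie in distinct components). A set $R$ of vertices of a finite graph $G$ is called multiset resolving if for all distinct vertices $v\neq w$ of $G$ the multisets $\{d_G(v,r): r\in R\}$ and $\{d_G(w,r): r\in R\}$ are distinct. The binomial random graph $\mathcal{G}(n,p)$ has $n$ labelled vertices, and each pair of vertices is an edge independently with probability $p$. For $x\in(0,1]$ and $y\in[0,1]$ let $$f_x(y)=\sum_{i=0}^{\lfloor 1/x\rfloor}\max\{ix+y-1,\,0\}.$$ Theorem. Let $x\in(0,1/8]$ be fixed. Then the equation $f_x(y)=4$ has a unique solution $y_4=y_4(x)$ in $(0,1)$. Moreover, if $p=p(n)\in[0,1]$ satisfies $(n-1)p=n^{x+O(1/\log n)}$, then with high probability $\mathcal{G}(n,p)$ has a multiset resolving set of size at most $n^{y_4+O(1/\log n)}$. Explicitly: for every real $K$ there is a real $C$, depending only on $x$ and $K$, such that for every sequence $p=p(n)\in[0,1]$ with $(n-1)p(n)=n^{x+\delta(n)}$ and $|\delta(n)|\le K/\log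 n$ for all sufficiently large $n$, the probability that $\mathcal{G}(n,p(n))$ has a multiset resolving set of size at most $n^{y_4+C/\log n}$ tends to $1$ as $n\to\infty$. -/

import Mathlib

open Filter Topology SimpleGraph

/-- The multiset `{d(v, r) : r ∈ R}` of graph distances from `v` to the vertices of `R`. Distances
are extended: vertices in distinct components have distance `⊤`. -/
noncomputable def distMultiset {V : Type*} (G : SimpleGraph V) (R : Finset V) (v : V) :
    Multiset ℕ∞ :=
  R.val.map fun r => G.edist v r

/-- `R` is multiset resolving for `G` if distinct vertices have distinct multisets of distances
to `R`. -/
def IsMultisetResolving {V : Type*} (G : SimpleGraph V) (R : Finset V) : Prop :=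
  ∀ v w : V, v ≠ w → distMultiset G R v ≠ distMultiset G R w

/-- The function `f_x(y) = ∑_{i=0}^{⌊1/x⌋} max {i x + y - 1, 0}`. -/
noncomputable def expFun (x y : ℝ) : ℝ :=
  ∑ i ∈ Finset.range (⌊1 / x⌋₊ + 1), max ((i : ℝ) * x + y - 1) 0

/-! The resolving set is random: every vertex is kept independently with probability q, a constant
times n^(y₄-1). Fix v ≠ w and let D_i (`distDiff`) be the set of vertices at distance i from v and
more than i from w. If v and w have equal multisets, then for each i as many kept vertices lie at
distance i from v as from w. Given the choices outside D_i, this prescribes the number of kept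
vertices in D_i, an event of probability at most 1/√(q|D_i|) by anticoncentration
(`choose_mul_pow_le`). The event for i does not involve D_j for j > i, so these bounds multiply
(`bernSum_prod_le`). If |D_i| ≥ c n^(ix) for all i ≤ 1/x, the product over the i with ix + y₄ - 1 >
0 is a small constant times n^(-f_x(y₄)/2) = n^(-2), which survives a union bound over pairs. This
explains the value 4.

The lower bound on |D_i| is proved by induction on i. With high probability every set A with p|A|
bounded has about np|A| new neighbours, even after discarding the neighbours of a set W of
comparable size (`real_not_isExpanding_le`). Taking A = D_i and W the rest of the two balls of
radius i, the surviving neighbours lie in D_(i+1) (`newNbrs_distDiff_subset`). -/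

/-- The expectation of `F T` where `T` is a random subset of `S` that contains every element of `S`
independently with probability `q`. -/
noncomputable def bernSum {α : Type*} [DecidableEq α] (S : Finset α) (q : ℝ)
    (F : Finset α → ℝ) : ℝ :=
  ∑ T ∈ S.powerset, q ^ T.card * (1 - q) ^ (S \ T).card * F T

/-! ### Random subsets with independent elements. -/

section BernSum

variable {α : Type*} [DecidableEq α] {S B : Finset α} {q : ℝ}

theorem bernSum_one (S : Finset α) (q : ℝ) : bernSum S q (fun _ => 1) = 1 := by
  have h := Finset.prod_add (fun _ : α => q) (fun _ => 1 - q) S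
  simpa [bernSum] using h.symm

theorem bernSum_mono (h0 : 0 ≤ q) (h1 : q ≤ 1) {F G : Finset α → ℝ}
    (h : ∀ T ⊆ S, F T ≤ G T) : bernSum S q F ≤ bernSum S q G := by
  refine Finset.sum_le_sum fun T hT => ?_
  have : 0 ≤ 1 - q := by linarith
  exact mul_le_mul_of_nonneg_left (h T (Finset.mem_powerset.1 hT)) (by positivity)

theorem bernSum_nonneg (h0 : 0 ≤ q) (h1 : q ≤ 1) {F : Finset α → ℝ}
    (h : ∀ T ⊆ S, 0 ≤ F T) : 0 ≤ bernSum S q F := by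
  refine Finset.sum_nonneg fun T hT => ?_
  have : 0 ≤ 1 - q := by linarith
  have := h T (Finset.mem_powerset.1 hT)
  positivity

theorem bernSum_const_mul (c : ℝ) (F : Finset α → ℝ) :
    bernSum S q (fun T => c * F T) = c * bernSum S q F := by
  simp only [bernSum, Finset.mul_sum]
  exact Finset.sum_congr rfl fun _ _ => by ring

theorem bernSum_sum {ι : Type*} (I : Finset ι) (F : ι → Finset α → ℝ) :
    bernSum S q (fun T => ∑ i ∈ I, F i T) = ∑ i ∈ I, bernSum S q (F i) := by
  simp only [bernSum, Finset.mul_sum]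
  exact Finset.sum_comm

theorem bernSum_add (F G : Finset α → ℝ) :
    bernSum S q (fun T => F T + G T) = bernSum S q F + bernSum S q G := by
  simp only [bernSum, mul_add, Finset.sum_add_distrib]

/-- Independence of the parts of the random set inside and outside `B`, in Fubini form. -/
theorem bernSum_split (hB : B ⊆ S) (F : Finset α → ℝ) :
    bernSum S q F = bernSum (S \ B) q fun T₂ => bernSum B q fun T₁ => F (T₁ ∪ T₂) := by
  simp only [bernSum, Finset.mul_sum]
  rw [← Finset.sum_product']
  refine Finset.sum_nbij' (fun T => (T \ B, T ∩ B)) (fun P => P.2 ∪ P.1) ?_ ?_ ?_ ?_ ?_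
  · intro T hT
    simp only [Finset.mem_product, Finset.mem_powerset] at hT ⊢
    exact ⟨Finset.sdiff_subset_sdiff hT le_rfl, Finset.inter_subset_right⟩
  · rintro ⟨P, Q⟩ h
    simp only [Finset.mem_product, Finset.mem_powerset] at h ⊢
    exact Finset.union_subset (h.2.trans hB) (h.1.trans Finset.sdiff_subset)
  · intro T hT
    ext a; simp; tauto
  · rintro ⟨P, Q⟩ h
    simp only [Finset.mem_product, Finset.mem_powerset] at h
    ext a
    · have h1 := @h.1 a
      have h2 := @h.2 a
      simp at h1 h2 ⊢; tauto
    · have h1 := @h.1 a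
      have h2 := @h.2 a
      simp at h1 h2 ⊢; tauto
  · intro T hT
    simp only [Finset.mem_powerset] at hT
    have e1 : T.card = (T \ B).card + (T ∩ B).card := by
      rw [Finset.card_sdiff_add_card_inter]
    have e2 : (S \ T).card = ((S \ B) \ (T \ B)).card + (B \ (T ∩ B)).card := by
      rw [← Finset.card_union_of_disjoint]
      · congr 1
        ext a
        have h1 := @hT a
        have h2 := @hB a
        simp; tauto
      · rw [Finset.disjoint_left]; intro a; simp; tauto
    have e3 : T ∩ B ∪ T \ B = T := by ext a; simp; tauto
    simp only [e1, e2, e3, pow_add]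
    ring

/-- A factor whose conditional expectation, given everything outside `B`, is at most `β`. -/
theorem bernSum_mul_le (h0 : 0 ≤ q) (h1 : q ≤ 1) (hB : B ⊆ S) {F g : Finset α → ℝ} {β : ℝ}
    (hF : ∀ T ⊆ S, 0 ≤ F T) (hFB : ∀ T ⊆ S, F T = F (T \ B))
    (hg : ∀ T₂ ⊆ S \ B, bernSum B q (fun T₁ => g (T₁ ∪ T₂)) ≤ β) :
    bernSum S q (fun T => F T * g T) ≤ β * bernSum S q F := by
  have key : ∀ T₁ ⊆ B, ∀ T₂ ⊆ S \ B, F (T₁ ∪ T₂) = F T₂ := by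
    intro T₁ hT₁ T₂ hT₂
    rw [hFB _ (Finset.union_subset (hT₁.trans hB) (hT₂.trans Finset.sdiff_subset))]
    congr 1
    ext a
    have h1 := @hT₁ a
    have h2 := @hT₂ a
    simp at h2 ⊢; tauto
  have e : ∀ T₂ ⊆ S \ B, ∀ h : Finset α → ℝ,
      bernSum B q (fun T₁ => F (T₁ ∪ T₂) * h T₁) = F T₂ * bernSum B q h := by
    intro T₂ hT₂ h
    rw [← bernSum_const_mul]
    refine Finset.sum_congr rfl fun T₁ hT₁ => ?_
    simp only [key T₁ (Finset.mem_powerset.1 hT₁) T₂ hT₂]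
  rw [bernSum_split hB, bernSum_split hB, ← bernSum_const_mul]
  refine bernSum_mono h0 h1 fun T₂ hT₂ => ?_
  rw [e T₂ hT₂ (fun T₁ => g (T₁ ∪ T₂))]
  have e' := e T₂ hT₂ (fun _ => 1)
  simp only [mul_one] at e'
  rw [e', bernSum_one, mul_one, mul_comm]
  exact mul_le_mul_of_nonneg_right (hg T₂ hT₂) (hF _ (hT₂.trans Finset.sdiff_subset))

/-- The largest index is peeled off first: the other factors do not see its set `A j`, so revealing
that set last costs a factor `β j`. The sets `A i` need not be disjoint, and `g i` may depend on `A
j` for j < i. -/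
theorem bernSum_prod_le {ι : Type*} [LinearOrder ι] (h0 : 0 ≤ q) (h1 : q ≤ 1) (I : Finset ι)
    (A : ι → Finset α) (g : ι → Finset α → ℝ) (β : ι → ℝ)
    (hA : ∀ i ∈ I, A i ⊆ S) (hg0 : ∀ i ∈ I, ∀ T ⊆ S, 0 ≤ g i T)
    (hgA : ∀ i ∈ I, ∀ j ∈ I, i < j → ∀ T ⊆ S, g i T = g i (T \ A j))
    (hg : ∀ i ∈ I, ∀ T₂ ⊆ S \ A i, bernSum (A i) q (fun T₁ => g i (T₁ ∪ T₂)) ≤ β i) :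
    bernSum S q (fun T => ∏ i ∈ I, g i T) ≤ ∏ i ∈ I, β i := by
  induction I using Finset.induction_on_max with
  | empty => simp [bernSum_one]
  | insert a s ha ih =>
    have hn : a ∉ s := fun h => lt_irrefl _ (ha a h)
    simp only [Finset.prod_insert hn]
    have hβ : 0 ≤ β a := by
      refine le_trans (bernSum_nonneg h0 h1 fun T hT => ?_)
        (hg a (Finset.mem_insert_self _ _) ∅ (Finset.empty_subset _))
      simpa using hg0 a (Finset.mem_insert_self _ _) T (hT.trans (hA a (Finset.mem_insert_self _ _)))
    have ih' := ih (fun i hi => hA i (Finset.mem_insert_of_mem hi))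
      (fun i hi => hg0 i (Finset.mem_insert_of_mem hi))
      (fun i hi j hj => hgA i (Finset.mem_insert_of_mem hi) j (Finset.mem_insert_of_mem hj))
      (fun i hi => hg i (Finset.mem_insert_of_mem hi))
    calc _ = bernSum S q (fun T => (∏ i ∈ s, g i T) * g a T) := by
          congr 1; funext T; ring
      _ ≤ β a * bernSum S q (fun T => ∏ i ∈ s, g i T) := by
          refine bernSum_mul_le h0 h1 (hA a (Finset.mem_insert_self _ _)) ?_ ?_
            (hg a (Finset.mem_insert_self _ _))
          · exact fun T hT => Finset.prod_nonneg fun i hi =>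
              hg0 i (Finset.mem_insert_of_mem hi) T hT
          · exact fun T hT => Finset.prod_congr rfl fun i hi =>
              hgA i (Finset.mem_insert_of_mem hi) a (Finset.mem_insert_self _ _) (ha i hi) T hT
      _ ≤ _ := mul_le_mul_of_nonneg_left ih' hβ

theorem bernSum_mem_le (h0 : 0 ≤ q) (h1 : q ≤ 1) {a : α} (ha : a ∈ S) :
    bernSum S q (fun T => if a ∈ T then 1 else 0) ≤ q := by
  have := bernSum_mul_le (F := fun _ => 1) (g := fun T => if a ∈ T then 1 else 0) (β := q)
    h0 h1 (Finset.singleton_subset_iff.2 ha) (by simp) (by simp) (by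
      intro T₂ hT₂
      have : a ∉ T₂ := fun h => by simpa using hT₂ h
      rw [← insert_empty_eq a, bernSum, Finset.sum_powerset_insert (Finset.notMem_empty a)]
      simp [this])
  simpa [bernSum_one] using this

theorem bernSum_card_le (h0 : 0 ≤ q) (h1 : q ≤ 1) :
    bernSum S q (fun T => (T.card : ℝ)) ≤ q * S.card := by
  calc _ ≤ bernSum S q (fun T => ∑ a ∈ S, if a ∈ T then 1 else 0) := by
        refine bernSum_mono h0 h1 fun T hT => ?_
        rw [Finset.sum_boole, Finset.filter_mem_eq_inter, Finset.inter_eq_right.2 hT]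
    _ ≤ ∑ a ∈ S, q := by
        rw [bernSum_sum]
        exact Finset.sum_le_sum fun a ha => bernSum_mem_le h0 h1 ha
    _ = _ := by simp [mul_comm]

end BernSum

/-! ### Anticoncentration of the binomial distribution by Fourier inversion. -/

theorem integral_cexp_int (m : ℤ) :
    ∫ t in (-Real.pi)..Real.pi, Complex.exp (m * t * Complex.I) =
      if m = 0 then (2 * Real.pi : ℂ) else 0 := by
  split_ifs with h
  · simp [h]; ring
  · have hc : (m * Complex.I : ℂ) ≠ 0 := by simp [h]
    have := integral_exp_mul_complex (a := -Real.pi) (b := Real.pi) hc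
    have e : ∀ t : ℝ, Complex.exp (m * t * Complex.I) = Complex.exp (m * Complex.I * t) := by
      intro t; congr 1; ring
    simp only [e, this]
    have : Complex.exp (m * Complex.I * Real.pi) = Complex.exp (m * Complex.I * (-Real.pi : ℝ)) := by
      rw [Complex.exp_eq_exp_iff_exists_int]
      exact ⟨m, by push_cast; ring⟩
    rw [this, sub_self, zero_div]

theorem binomial_fourier (m k : ℕ) (hk : k ≤ m) (q : ℝ) :
    ∫ t in (-Real.pi)..Real.pi,
        ((1 - q : ℂ) + q * Complex.exp (t * Complex.I)) ^ m * Complex.exp (-(k * t * Complex.I)) =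
      2 * Real.pi * (m.choose k * q ^ k * (1 - q) ^ (m - k)) := by
  have e : ∀ t : ℝ, ((1 - q : ℂ) + q * Complex.exp (t * Complex.I)) ^ m *
      Complex.exp (-(k * t * Complex.I)) = ∑ j ∈ Finset.range (m + 1),
        (m.choose j * q ^ j * (1 - q) ^ (m - j) : ℂ) *
          Complex.exp (((j : ℤ) - (k : ℤ) : ℤ) * t * Complex.I) := by
    intro t
    rw [add_comm, add_pow, Finset.sum_mul]
    refine Finset.sum_congr rfl fun j _ => ?_
    have : Complex.exp (((j : ℤ) - (k : ℤ) : ℤ) * t * Complex.I) =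
        Complex.exp (t * Complex.I) ^ j * Complex.exp (-(k * t * Complex.I)) := by
      rw [← Complex.exp_nat_mul, ← Complex.exp_add]
      congr 1; push_cast; ring
    rw [this, mul_pow]; ring
  simp only [e]
  rw [intervalIntegral.integral_finsetSum]
  · simp only [intervalIntegral.integral_const_mul, integral_cexp_int]
    rw [Finset.sum_eq_single k]
    · simp; ring
    · intro j _ hj
      have : (j : ℤ) - (k : ℤ) ≠ 0 := by omega
      simp [this]
    · intro h; simp at h; omega
  · intro j _
    apply Continuous.intervalIntegrable
    fun_prop

/-- The squared modulus of the base is 1 - 2q(1-q)(1 - cos t). Here 2(1-q) ≥ 1, and 1 - cos t ≥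
2t²/π² on [-π, π]. -/
theorem norm_bernoulli_char_pow_le {q t : ℝ} (h0 : 0 ≤ q) (h1 : q ≤ 1 / 2) (ht : |t| ≤ Real.pi)
    (m : ℕ) : ‖((1 - q : ℂ) + q * Complex.exp (t * Complex.I)) ^ m‖ ≤
      Real.exp (-(q * m / Real.pi ^ 2) * t ^ 2) := by
  have hsq : ‖(1 - q : ℂ) + q * Complex.exp (t * Complex.I)‖ ^ 2 =
      1 - 2 * q * (1 - q) * (1 - Real.cos t) := by
    rw [← Complex.normSq_eq_norm_sq, Complex.normSq_apply]
    simp [Complex.exp_ofReal_mul_I_re, Complex.exp_ofReal_mul_I_im]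
    linear_combination q ^ 2 * Real.sin_sq_add_cos_sq t
  have hcos := Real.cos_le_one_sub_mul_cos_sq ht
  have hb : ‖(1 - q : ℂ) + q * Complex.exp (t * Complex.I)‖ ^ 2 ≤
      Real.exp (-(q / Real.pi ^ 2) * t ^ 2) ^ 2 := by
    rw [hsq, ← Real.exp_nat_mul]
    have h2 : q * (1 - Real.cos t) ≤ 2 * q * (1 - q) * (1 - Real.cos t) := by
      have := Real.cos_le_one t
      apply mul_le_mul_of_nonneg_right _ (by linarith)
      nlinarith
    have h3 : q * (2 / Real.pi ^ 2 * t ^ 2) ≤ q * (1 - Real.cos t) :=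
      mul_le_mul_of_nonneg_left (by linarith) h0
    have h4 := Real.add_one_le_exp (((2 : ℕ) : ℝ) * (-(q / Real.pi ^ 2) * t ^ 2))
    refine le_trans ?_ h4
    push_cast
    have : (2 : ℝ) * (-(q / Real.pi ^ 2) * t ^ 2) = - (q * (2 / Real.pi ^ 2 * t ^ 2)) := by ring
    rw [this]
    linarith
  have hb' := (sq_le_sq₀ (norm_nonneg _) (Real.exp_pos _).le).1 hb
  rw [norm_pow]
  calc _ ≤ Real.exp (-(q / Real.pi ^ 2) * t ^ 2) ^ m := pow_le_pow_left₀ (norm_nonneg _) hb' m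
    _ = _ := by rw [← Real.exp_nat_mul]; congr 1; ring

/-- Anticoncentration of the binomial distribution. -/
theorem choose_mul_pow_le {q : ℝ} (h0 : 0 < q) (h1 : q ≤ 1 / 2) {m : ℕ} (hm : 0 < m) (k : ℕ) :
    m.choose k * q ^ k * (1 - q) ^ (m - k) ≤ 1 / Real.sqrt (q * m) := by
  have hm' : (0 : ℝ) < m := by exact_mod_cast hm
  rcases lt_or_ge m k with hk | hk
  · rw [Nat.choose_eq_zero_of_lt hk, Nat.cast_zero, zero_mul, zero_mul]
    positivity
  have hpi := Real.pi_pos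
  have hF := binomial_fourier m k hk q
  have hq1 : 0 ≤ 1 - q := by linarith
  set b : ℝ := m.choose k * q ^ k * (1 - q) ^ (m - k) with hb
  have hnorm : ‖∫ t in (-Real.pi)..Real.pi,
        ((1 - q : ℂ) + q * Complex.exp (t * Complex.I)) ^ m *
          Complex.exp (-(k * t * Complex.I))‖ = 2 * Real.pi * b := by
    rw [hF]
    have : (2 * Real.pi * (m.choose k * q ^ k * (1 - q) ^ (m - k)) : ℂ) =
      ((2 * Real.pi * b : ℝ) : ℂ) := by rw [hb]; push_cast; ring
    rw [this, Complex.norm_real, Real.norm_of_nonneg]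
    rw [hb]; positivity
  have hc : 0 < q * m / Real.pi ^ 2 := by positivity
  have hint := integrable_exp_neg_mul_sq hc
  -- The inversion integral is dominated by a Gaussian integral over the whole line.
  have hle : 2 * Real.pi * b ≤ Real.sqrt (Real.pi / (q * m / Real.pi ^ 2)) := by
    rw [← hnorm, ← integral_gaussian]
    calc _ ≤ ∫ t in (-Real.pi)..Real.pi, Real.exp (-(q * m / Real.pi ^ 2) * t ^ 2) := by
          refine intervalIntegral.norm_integral_le_of_norm_le (by linarith) ?_
            hint.intervalIntegrable
          refine Filter.Eventually.of_forall fun t ht => ?_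
          have hn : ‖Complex.exp (-(k * t * Complex.I))‖ = 1 := by
            have : (-(k * t * Complex.I) : ℂ) = ((-(k * t) : ℝ) : ℂ) * Complex.I := by
              push_cast; ring
            rw [this, Complex.norm_exp_ofReal_mul_I]
          rw [norm_mul, hn, mul_one]
          exact norm_bernoulli_char_pow_le h0.le h1 (abs_le.2 ⟨ht.1.le, ht.2⟩) m
      _ ≤ _ := by
          rw [intervalIntegral.integral_of_le (by linarith)]
          exact MeasureTheory.setIntegral_le_integral hint
            (Filter.Eventually.of_forall fun t => (Real.exp_pos _).le)
  have e : Real.pi / (q * m / Real.pi ^ 2) = Real.pi * (Real.pi ^ 2 / (q * m)) := by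
    field_simp
  have hs : Real.sqrt (Real.pi / (q * m / Real.pi ^ 2)) =
      Real.sqrt Real.pi * (Real.pi / Real.sqrt (q * m)) := by
    rw [e, Real.sqrt_mul hpi.le, Real.sqrt_div (by positivity), Real.sqrt_sq hpi.le]
  rw [hs] at hle
  -- The Gaussian bound is b ≤ (√π / 2) / √(qm), so this makes the constant 1.
  have h2 : Real.sqrt Real.pi ≤ 2 := by
    rw [Real.sqrt_le_left (by norm_num)]
    linarith [Real.pi_le_four]
  have hpos : 0 < Real.sqrt (q * m) := Real.sqrt_pos.2 (by positivity)
  have : 2 * Real.pi * b ≤ 2 * (Real.pi / Real.sqrt (q * m)) :=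
    hle.trans (mul_le_mul_of_nonneg_right h2 (by positivity))
  have e2 : 2 * (Real.pi / Real.sqrt (q * m)) = 2 * Real.pi * (1 / Real.sqrt (q * m)) := by ring
  rw [e2] at this
  exact le_of_mul_le_mul_left this (by positivity)

theorem bernSum_card_eq_le {α : Type*} [DecidableEq α] {q : ℝ} (h0 : 0 < q) (h1 : q ≤ 1 / 2)
    {B : Finset α} (hB : 0 < B.card) (k : ℕ) :
    bernSum B q (fun T => if T.card = k then 1 else 0) ≤ 1 / Real.sqrt (q * B.card) := by
  refine le_trans (le_of_eq ?_) (choose_mul_pow_le h0 h1 hB k)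
  have : ∀ T ∈ B.powerset, q ^ T.card * (1 - q) ^ (B \ T).card * (if T.card = k then 1 else 0) =
      if T.card = k then q ^ k * (1 - q) ^ (B.card - k) else 0 := by
    intro T hT
    split_ifs with h
    · rw [Finset.card_sdiff_of_subset (Finset.mem_powerset.1 hT), h, mul_one]
    · simp
  rw [bernSum, Finset.sum_congr rfl this, ← Finset.sum_filter, Finset.sum_const,
    ← Finset.powersetCard_eq_filter, Finset.card_powersetCard, nsmul_eq_mul, mul_assoc]

/-! ### A random vertex set separates all pairs. -/

section Resolving

open scoped Classical

variable {V : Type*} [Fintype V]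

/-- The vertices at distance exactly `i` from `v` and more than `i` from `w`. -/
noncomputable def distDiff (G : SimpleGraph V) (v w : V) (i : ℕ) : Finset V :=
  Finset.univ.filter fun u => G.edist v u = i ∧ (i : ℕ∞) < G.edist w u

theorem mem_distDiff {G : SimpleGraph V} {v w u : V} {i : ℕ} :
    u ∈ distDiff G v w i ↔ G.edist v u = i ∧ (i : ℕ∞) < G.edist w u := by
  simp [distDiff]

omit [Fintype V] in
theorem card_filter_eq_of_distMultiset_eq {G : SimpleGraph V} {R : Finset V} {v w : V}
    (h : distMultiset G R v = distMultiset G R w) (i : ℕ) :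
    (R.filter fun u => G.edist v u = i).card = (R.filter fun u => G.edist w u = i).card := by
  have := congrArg (Multiset.count (i : ℕ∞)) h
  simpa only [distMultiset, Multiset.count_map, eq_comm (a := (i : ℕ∞)), Finset.card_def,
    Finset.filter_val] using this

/-- The probability that a random set does not separate `v` and `w`. -/
theorem bernSum_distMultiset_eq_le (G : SimpleGraph V) {v w : V} {I : Finset ℕ} {q : ℝ}
    (h0 : 0 < q) (h1 : q ≤ 1 / 2) (hD : ∀ i ∈ I, 0 < (distDiff G v w i).card) :
    bernSum Finset.univ q
        (fun R => if distMultiset G R v = distMultiset G R w then 1 else 0) ≤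
      ∏ i ∈ I, 1 / Real.sqrt (q * (distDiff G v w i).card) := by
  have h1' : q ≤ 1 := by linarith
  set g : ℕ → Finset V → ℝ := fun i R =>
    if (R.filter fun u => G.edist v u = i).card = (R.filter fun u => G.edist w u = i).card
      then 1 else 0 with hg
  refine le_trans (bernSum_mono (G := fun R => ∏ i ∈ I, g i R) h0.le h1' fun R _ => ?_)
    (bernSum_prod_le h0.le h1' I (distDiff G v w) g _ ?_ ?_ ?_ ?_)
  · split_ifs with h
    · refine (Finset.prod_eq_one fun i _ => ?_).ge
      simp only [hg, card_filter_eq_of_distMultiset_eq h, if_true]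
    · exact Finset.prod_nonneg fun i _ => by simp only [hg]; split_ifs <;> norm_num
  · simp
  · intro i _ T _; simp only [hg]; split_ifs <;> norm_num
  -- Vertices of D_j are at distance j from v and more than j from w, so for i < j they enter
  -- neither count at distance i.
  · intro i _ j _ hij T _
    have e1 : (T \ distDiff G v w j).filter (fun u => G.edist v u = i) =
        T.filter fun u => G.edist v u = i := by
      ext u
      simp only [Finset.mem_filter, Finset.mem_sdiff, mem_distDiff]
      refine ⟨fun h => ⟨h.1.1, h.2⟩, fun h => ⟨⟨h.1, fun hu => ?_⟩, h.2⟩⟩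
      have := h.2.symm.trans hu.1
      exact hij.ne (by exact_mod_cast this)
    have e2 : (T \ distDiff G v w j).filter (fun u => G.edist w u = i) =
        T.filter fun u => G.edist w u = i := by
      ext u
      simp only [Finset.mem_filter, Finset.mem_sdiff, mem_distDiff]
      refine ⟨fun h => ⟨h.1.1, h.2⟩, fun h => ⟨⟨h.1, fun hu => ?_⟩, h.2⟩⟩
      have := hu.2
      rw [h.2] at this
      exact absurd hij (not_lt.2 (by exact_mod_cast this.le))
    simp only [hg, e1, e2]
  -- With the choices outside D_i fixed as `T₂`, the count for w is constant and the count for v is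
  -- a constant plus |T₁|. Hence equality forces one value of |T₁|; truncated subtraction is
  -- harmless because only this implication is needed.
  · intro i hi T₂ hT₂
    refine le_trans (bernSum_mono h0.le h1' fun T₁ hT₁ => ?_)
      (bernSum_card_eq_le h0 h1 (hD i hi) ((T₂.filter fun u => G.edist w u = i).card -
        (T₂.filter fun u => G.edist v u = i).card))
    have e1 : ((T₁ ∪ T₂).filter fun u => G.edist v u = i).card =
        T₁.card + (T₂.filter fun u => G.edist v u = i).card := by
      rw [Finset.filter_union, Finset.filter_true_of_mem fun u hu => (mem_distDiff.1 (hT₁ hu)).1,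
        Finset.card_union_of_disjoint]
      rw [Finset.disjoint_left]
      intro u hu hu'
      exact (Finset.mem_sdiff.1 (hT₂ (Finset.mem_filter.1 hu').1)).2 (hT₁ hu)
    have e2 : (T₁ ∪ T₂).filter (fun u => G.edist w u = i) =
        T₂.filter fun u => G.edist w u = i := by
      rw [Finset.filter_union, Finset.filter_false_of_mem, Finset.empty_union]
      exact fun u hu => (mem_distDiff.1 (hT₁ hu)).2.ne'
    simp only [hg, e1, e2]
    split_ifs with h h'
    · exact le_rfl
    · omega
    · exact zero_le_one
    · exact le_rfl

/-- First moment method: the expected number of unseparated ordered pairs plus the expectation of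
|R|/(2qn) is at most 1/4 + 1/2. If every resolving set were too large, this sum would be at least 1
for every R. -/
theorem exists_isMultisetResolving [Nonempty V] (G : SimpleGraph V) {I : Finset ℕ} {q : ℝ}
    {b : ℕ → ℝ} (h0 : 0 < q) (h1 : q ≤ 1 / 2) (hb : ∀ i ∈ I, 0 < b i)
    (hD : ∀ v w, v ≠ w → ∀ i ∈ I, b i ≤ (distDiff G v w i).card)
    (hprod : (Fintype.card V : ℝ) ^ 2 * ∏ i ∈ I, 1 / Real.sqrt (q * b i) ≤ 1 / 4) :
    ∃ R : Finset V, IsMultisetResolving G R ∧ (R.card : ℝ) ≤ 2 * (q * Fintype.card V) := by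
  by_contra! hcon
  have h1' : q ≤ 1 := by linarith
  have hV : (0 : ℝ) < Fintype.card V := by exact_mod_cast Fintype.card_pos
  have hpair : ∀ z ∈ (Finset.univ : Finset V).offDiag, bernSum Finset.univ q
      (fun R => if distMultiset G R z.1 = distMultiset G R z.2 then 1 else 0) ≤
        ∏ i ∈ I, 1 / Real.sqrt (q * b i) := by
    rintro ⟨v, w⟩ hz
    have hvw : v ≠ w := by simpa using hz
    have hpos : ∀ i ∈ I, (0 : ℝ) < (distDiff G v w i).card :=
      fun i hi => (hb i hi).trans_le (hD v w hvw i hi)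
    refine (bernSum_distMultiset_eq_le G (I := I) h0 h1
      fun i hi => by exact_mod_cast hpos i hi).trans ?_
    refine Finset.prod_le_prod (fun _ _ => by positivity) fun i hi => ?_
    have := hb i hi
    exact one_div_le_one_div_of_le (Real.sqrt_pos.2 (by positivity))
      (Real.sqrt_le_sqrt (mul_le_mul_of_nonneg_left (hD v w hvw i hi) h0.le))
  have hone : (1 : ℝ) ≤ bernSum (Finset.univ : Finset V) q (fun R =>
      (∑ z ∈ (Finset.univ : Finset V).offDiag,
        if distMultiset G R z.1 = distMultiset G R z.2 then 1 else 0) +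
      (2 * (q * Fintype.card V))⁻¹ * R.card) := by
    refine (bernSum_one (Finset.univ : Finset V) q).symm.le.trans
      (bernSum_mono h0.le h1' fun R _ => ?_)
    by_cases hR : IsMultisetResolving G R
    · have := hcon R hR
      have h2 : 1 ≤ (2 * (q * Fintype.card V))⁻¹ * R.card := by
        rw [inv_mul_eq_div, one_le_div (by positivity)]
        exact this.le
      refine h2.trans (le_add_of_nonneg_left (Finset.sum_nonneg fun z _ => ?_))
      split_ifs <;> norm_num
    · simp only [IsMultisetResolving, not_forall, not_not] at hR
      obtain ⟨v, w, hvw, he⟩ := hR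
      refine le_add_of_le_of_nonneg ?_ (by positivity)
      refine le_trans ?_ (Finset.single_le_sum (a := (v, w)) (fun z _ => ?_) (by simpa using hvw))
      · simp [he]
      · split_ifs <;> norm_num
  rw [bernSum_add, bernSum_sum, bernSum_const_mul] at hone
  have hA := Finset.sum_le_card_nsmul _ _ _ hpair
  have hcard : ((Finset.univ : Finset V).offDiag.card : ℝ) ≤ (Fintype.card V : ℝ) ^ 2 := by
    rw [Finset.offDiag_card, Finset.card_univ, sq]
    exact_mod_cast Nat.sub_le _ _
  have hP : 0 ≤ ∏ i ∈ I, 1 / Real.sqrt (q * b i) := Finset.prod_nonneg fun _ _ => by positivity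
  rw [nsmul_eq_mul] at hA
  have hB := mul_le_mul_of_nonneg_right hcard hP
  have hC : (2 * (q * Fintype.card V))⁻¹ * bernSum (Finset.univ : Finset V) q
      (fun R => (R.card : ℝ)) ≤ 1 / 2 := by
    calc _ ≤ (2 * (q * Fintype.card V))⁻¹ * (q * Fintype.card V) := by
          gcongr
          simpa using bernSum_card_le (S := (Finset.univ : Finset V)) h0.le h1'
      _ = 1 / 2 := by field_simp
  linarith

end Resolving

/-! ### The random graph as a random edge set, and its neighbourhoods. -/

section BinomialRandom

open scoped Classical

/-- The potential edges of a graph on `Fin n`. -/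
noncomputable def allEdges (n : ℕ) : Finset (Sym2 (Fin n)) :=
  Finset.univ.filter fun e => ¬ e.IsDiag

theorem mem_allEdges {n : ℕ} {e : Sym2 (Fin n)} : e ∈ allEdges n ↔ ¬ e.IsDiag := by
  simp [allEdges]

theorem edgeSet_fromEdgeSet_coe {n : ℕ} {T : Finset (Sym2 (Fin n))} (hT : T ⊆ allEdges n) :
    (fromEdgeSet (T : Set (Sym2 (Fin n)))).edgeSet = T := by
  rw [edgeSet_fromEdgeSet]
  ext e
  simp only [Set.mem_sdiff, Finset.mem_coe, and_iff_left_iff_imp]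
  exact fun h => mem_allEdges.1 (hT h)

theorem binomialRandom_real_eq_bernSum {n : ℕ} (p : unitInterval)
    (P : SimpleGraph (Fin n) → Prop) :
    (binomialRandom (Fin n) p).real {G | P G} = bernSum (allEdges n) p fun T =>
      if P (fromEdgeSet (T : Set (Sym2 (Fin n)))) then 1 else 0 := by
  have h1 : {G | P G} = ((Finset.univ.filter P : Finset (SimpleGraph (Fin n))) : Set _) := by
    ext; simp
  have : MeasurableSingletonClass (SimpleGraph (Fin n)) := ⟨fun G => by
    have h := measurableEmbedding_edgeSet.measurable (measurableSet_singleton G.edgeSet)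
    rwa [← Set.image_singleton, edgeSet_injective.preimage_image] at h⟩
  rw [h1, ← MeasureTheory.sum_measureReal_singleton, Finset.sum_filter, bernSum]
  refine Finset.sum_nbij' (fun G => G.edgeFinset) (fun T => fromEdgeSet (T : Set (Sym2 (Fin n))))
    ?_ ?_ ?_ ?_ ?_
  · intro G _
    rw [Finset.mem_powerset]
    intro e he
    exact mem_allEdges.2 (G.not_isDiag_of_mem_edgeFinset he)
  · simp
  · intro G _; simp
  · intro T hT
    rw [← Finset.coe_inj, coe_edgeFinset, edgeSet_fromEdgeSet_coe (Finset.mem_powerset.1 hT)]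
  · intro G _
    have hG : G.edgeFinset ⊆ allEdges n :=
      fun e he => mem_allEdges.2 (G.not_isDiag_of_mem_edgeFinset he)
    have hE : (allEdges n).card = n.choose 2 := by
      have := Sym2.card_diagSet_compl (α := Fin n)
      rw [Fintype.card_fin] at this
      rw [← this, allEdges, Fintype.card_subtype]
      congr 1
    rw [coe_edgeFinset, fromEdgeSet_edgeSet, mul_ite, mul_one, mul_zero]
    congr 1
    rw [MeasureTheory.measureReal_def, binomialRandom_singleton, Finset.card_sdiff_of_subset hG, hE,
      ← coe_edgeFinset, Set.ncard_coe_finset, Nat.card_eq_fintype_card, Fintype.card_fin]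
    simp

theorem bernSum_disjoint {α : Type*} [DecidableEq α] {S Z : Finset α} (hZ : Z ⊆ S) (q : ℝ) :
    bernSum S q (fun T => if Disjoint T Z then 1 else 0) = (1 - q) ^ Z.card := by
  rw [bernSum_split hZ]
  have : ∀ T₂ ∈ (S \ Z).powerset, bernSum Z q
      (fun T₁ => if Disjoint (T₁ ∪ T₂) Z then 1 else 0) = (1 - q) ^ Z.card * 1 := by
    intro T₂ hT₂
    have h2 : Disjoint T₂ Z :=
      Finset.disjoint_of_subset_left (Finset.mem_powerset.1 hT₂) Finset.sdiff_disjoint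
    rw [bernSum, Finset.sum_eq_single ∅]
    · simp [h2]
    · intro T₁ hT₁ hne
      have : ¬ Disjoint T₁ Z := fun h =>
        hne (Finset.disjoint_self_iff_empty _ |>.1 (h.mono_right (Finset.mem_powerset.1 hT₁)))
      simp [Finset.disjoint_union_left, this]
    · simp
  calc _ = bernSum (S \ Z) q (fun _ => (1 - q) ^ Z.card * 1) :=
        Finset.sum_congr rfl fun T₂ hT₂ => by simp only [this T₂ hT₂]
    _ = _ := by rw [bernSum_const_mul, bernSum_one, mul_one]

/-- The indicator of hitting X and missing Y is the indicator of missing Y minus that of missing X ∪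
Y. -/
theorem bernSum_not_disjoint_and_disjoint {α : Type*} [DecidableEq α] {S X Y : Finset α}
    (hX : X ⊆ S) (hY : Y ⊆ S) (hXY : Disjoint X Y) (q z : ℝ) :
    bernSum S q (fun T => if ¬ Disjoint T X ∧ Disjoint T Y then z else 1) =
      1 + (z - 1) * ((1 - q) ^ Y.card - (1 - q) ^ (X.card + Y.card)) := by
  have e : (fun T => if ¬ Disjoint T X ∧ Disjoint T Y then z else 1) =
      fun T => 1 + ((z - 1) * (if Disjoint T Y then 1 else 0) +
        (1 - z) * (if Disjoint T (X ∪ Y) then 1 else 0)) := by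
    funext T
    simp only [Finset.disjoint_union_right]
    by_cases h1 : Disjoint T X <;> by_cases h2 : Disjoint T Y <;> simp [h1, h2]
  rw [e, bernSum_add, bernSum_add, bernSum_const_mul, bernSum_const_mul, bernSum_one,
    bernSum_disjoint hY, bernSum_disjoint (Finset.union_subset hX hY),
    Finset.card_union_of_disjoint hXY]
  ring

/-- The vertices outside `A ∪ W` with a neighbour in `A` but none in `W`. -/
noncomputable def newNbrs {n : ℕ} (G : SimpleGraph (Fin n)) (A W : Finset (Fin n)) :
    Finset (Fin n) :=
  (A ∪ W)ᶜ.filter fun u => (∃ a ∈ A, G.Adj a u) ∧ ∀ w ∈ W, ¬ G.Adj w u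

theorem mem_newNbrs {n : ℕ} {G : SimpleGraph (Fin n)} {A W : Finset (Fin n)} {u : Fin n} :
    u ∈ newNbrs G A W ↔
      u ∈ (A ∪ W)ᶜ ∧ (∃ a ∈ A, G.Adj a u) ∧ ∀ w ∈ W, ¬ G.Adj w u := by
  simp only [newNbrs, Finset.mem_filter]

/-- The potential edges from `u` to `A`. -/
def starEdges {n : ℕ} (A : Finset (Fin n)) (u : Fin n) : Finset (Sym2 (Fin n)) :=
  A.image fun a => s(a, u)

theorem mem_starEdges {n : ℕ} {A : Finset (Fin n)} {u : Fin n} {e : Sym2 (Fin n)} :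
    e ∈ starEdges A u ↔ ∃ a ∈ A, s(a, u) = e := by simp [starEdges]

theorem card_starEdges {n : ℕ} (A : Finset (Fin n)) (u : Fin n) : (starEdges A u).card = A.card :=
  Finset.card_image_of_injective _ fun _ _ h => Sym2.congr_left.1 h

theorem disjoint_starEdges {n : ℕ} {A A' : Finset (Fin n)} {u u' : Fin n}
    (h : u = u' → Disjoint A A') (hu : u ∉ A') : Disjoint (starEdges A u) (starEdges A' u') := by
  rw [Finset.disjoint_left]
  intro e he he'
  obtain ⟨a, ha, rfl⟩ := mem_starEdges.1 he
  obtain ⟨a', ha', h'⟩ := mem_starEdges.1 he'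
  rcases Sym2.eq_iff.1 h' with ⟨rfl, rfl⟩ | ⟨rfl, rfl⟩
  · exact Finset.disjoint_left.1 (h rfl) ha ha'
  · exact hu ha'

theorem starEdges_subset_allEdges {n : ℕ} {A : Finset (Fin n)} {u : Fin n} (hu : u ∉ A) :
    starEdges A u ⊆ allEdges n := by
  intro e he
  obtain ⟨a, ha, rfl⟩ := mem_starEdges.1 he
  rw [mem_allEdges, Sym2.mk_isDiag_iff]
  rintro rfl
  exact hu ha

theorem not_disjoint_starEdges_iff {n : ℕ} {A : Finset (Fin n)} {u : Fin n}
    {T : Finset (Sym2 (Fin n))} (hu : u ∉ A) :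
    ¬ Disjoint T (starEdges A u) ↔ ∃ a ∈ A, (fromEdgeSet (T : Set (Sym2 (Fin n)))).Adj a u := by
  rw [Finset.not_disjoint_iff]
  constructor
  · rintro ⟨e, heT, he⟩
    obtain ⟨a, ha, rfl⟩ := mem_starEdges.1 he
    exact ⟨a, ha, (fromEdgeSet_adj _).2 ⟨heT, fun h => hu (h ▸ ha)⟩⟩
  · rintro ⟨a, ha, h⟩
    exact ⟨s(a, u), ((fromEdgeSet_adj _).1 h).1, mem_starEdges.2 ⟨a, ha, rfl⟩⟩

/-- Whether u is a new neighbour depends only on the edges from u to A ∪ W. For distinct u outside A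
∪ W these edge sets are disjoint, so the generating function factors. It is used with z = 2 for
upper tails and z = 1/2 for lower tails. -/
theorem bernSum_pow_card_newNbrs_le {n : ℕ} {A W : Finset (Fin n)} (hAW : Disjoint A W) {q z : ℝ}
    (h0 : 0 ≤ q) (h1 : q ≤ 1) (hz : 0 ≤ z) :
    bernSum (allEdges n) q
        (fun T => z ^ (newNbrs (fromEdgeSet (T : Set (Sym2 (Fin n)))) A W).card) ≤
      (1 + (z - 1) * ((1 - q) ^ W.card - (1 - q) ^ (A.card + W.card))) ^ ((A ∪ W)ᶜ).card := by
  set g : Fin n → Finset (Sym2 (Fin n)) → ℝ := fun u T =>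
    if ¬ Disjoint T (starEdges A u) ∧ Disjoint T (starEdges W u) then z else 1 with hg
  have hmem : ∀ u ∈ (A ∪ W)ᶜ, u ∉ A ∧ u ∉ W := by
    intro u hu; simpa using hu
  have hprod : ∀ T : Finset (Sym2 (Fin n)),
      z ^ (newNbrs (fromEdgeSet (T : Set (Sym2 (Fin n)))) A W).card =
        ∏ u ∈ (A ∪ W)ᶜ, g u T := by
    intro T
    rw [newNbrs, ← Finset.prod_const, Finset.prod_filter]
    refine Finset.prod_congr rfl fun u hu => ?_
    obtain ⟨hA, hW⟩ := hmem u hu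
    have e := not_disjoint_starEdges_iff (T := T) hA
    have e' := not_iff_not.2 (not_disjoint_starEdges_iff (T := T) hW)
    rw [not_not] at e'
    push Not at e'
    have h := and_congr e e'
    by_cases hh : ¬ Disjoint T (starEdges A u) ∧ Disjoint T (starEdges W u)
    · simp only [hg]
      rw [if_pos hh, if_pos (h.1 hh)]
    · simp only [hg]
      rw [if_neg hh, if_neg fun h' => hh (h.2 h')]
  simp only [hprod]
  refine (bernSum_prod_le h0 h1 _ (fun u => starEdges (A ∪ W) u) g
    (fun _ => 1 + (z - 1) * ((1 - q) ^ W.card - (1 - q) ^ (A.card + W.card)))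
    ?_ ?_ ?_ ?_).trans (by rw [Finset.prod_const])
  · exact fun u hu => starEdges_subset_allEdges (Finset.mem_compl.1 hu)
  · intro u _ T _
    simp only [hg]; split_ifs <;> linarith
  · intro u hu u' hu' huu' T _
    obtain ⟨hA, hW⟩ := hmem u' hu'
    have key : ∀ X : Finset (Fin n), u' ∉ X →
        (Disjoint T (starEdges X u) ↔ Disjoint (T \ starEdges (A ∪ W) u') (starEdges X u)) := by
      intro X hX
      have hd : Disjoint (starEdges (A ∪ W) u') (starEdges X u) :=
        disjoint_starEdges (fun h => absurd h huu'.ne') hX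
      rw [Finset.disjoint_left, Finset.disjoint_left]
      refine ⟨fun h e he => h (Finset.mem_sdiff.1 he).1, fun h e he he' => ?_⟩
      exact h (Finset.mem_sdiff.2 ⟨he, fun h' => Finset.disjoint_left.1 hd h' he'⟩) he'
    simp only [hg, ← key A hA, ← key W hW]
  · intro u hu T₂ hT₂
    obtain ⟨hA, hW⟩ := hmem u hu
    have hsubA : starEdges A u ⊆ starEdges (A ∪ W) u := Finset.image_subset_image Finset.subset_union_left
    have hsubW : starEdges W u ⊆ starEdges (A ∪ W) u := Finset.image_subset_image Finset.subset_union_right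
    have hd : Disjoint T₂ (starEdges (A ∪ W) u) :=
      Finset.disjoint_of_subset_left hT₂ Finset.sdiff_disjoint
    have hdA := hd.mono_right hsubA
    have hdW := hd.mono_right hsubW
    simp only [hg, Finset.disjoint_union_left, hdA, hdW, and_true]
    rw [bernSum_not_disjoint_and_disjoint hsubA hsubW (disjoint_starEdges (fun _ => hAW) hW), card_starEdges,
      card_starEdges]

end BinomialRandom

/-! ### Degree bounds and uniform expansion. -/

section Expansion

open scoped Classical

/-- The right side is the chance that a vertex has a neighbour in A and none in W. Since pw ≤ M · pa
≤ M², avoiding W costs a constant factor, and 1 - (1-p)^a ≥ pa/(1 + pa). -/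
theorem one_sub_pow_sub_ge {p M : ℝ} {a w : ℕ} (h0 : 0 ≤ p) (h1 : p ≤ 1 / 2) (hM : 0 ≤ M)
    (hw : (w : ℝ) ≤ M * a) (ha : p * a ≤ M) :
    Real.exp (-(2 * M ^ 2)) / (1 + M) * (p * a) ≤ (1 - p) ^ w - (1 - p) ^ (a + w) := by
  have hq : 0 ≤ 1 - p := by linarith
  have e : (1 - p) ^ w - (1 - p) ^ (a + w) = (1 - p) ^ w * (1 - (1 - p) ^ a) := by
    rw [pow_add]; ring
  have h2 : Real.exp (-(2 * p)) ≤ 1 - p := by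
    rw [Real.exp_neg, inv_le_comm₀ (Real.exp_pos _) (by linarith)]
    have h3 := Real.add_one_le_exp (2 * p)
    refine le_trans ?_ h3
    rw [inv_le_iff_one_le_mul₀ (by linarith)]
    nlinarith
  have hA : Real.exp (-(2 * M ^ 2)) ≤ (1 - p) ^ w := by
    calc _ ≤ Real.exp (-(2 * p)) ^ w := by
          rw [← Real.exp_nat_mul, Real.exp_le_exp]
          have : p * w ≤ M * M := by
            calc p * w ≤ p * (M * a) := mul_le_mul_of_nonneg_left hw h0
              _ = M * (p * a) := by ring
              _ ≤ M * M := mul_le_mul_of_nonneg_left ha hM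
          nlinarith
      _ ≤ _ := pow_le_pow_left₀ (Real.exp_pos _).le h2 w
  have hpa : 0 ≤ p * a := by positivity
  have hB : p * a / (1 + M) ≤ 1 - (1 - p) ^ a := by
    have h3 : (1 - p) ^ a ≤ Real.exp (-(p * a)) := by
      have := pow_le_pow_left₀ hq (Real.one_sub_le_exp_neg p) a
      rw [← Real.exp_nat_mul] at this
      refine this.trans (le_of_eq ?_)
      congr 1; ring
    have h4 : Real.exp (-(p * a)) ≤ 1 / (1 + p * a) := by
      rw [Real.exp_neg, one_div]
      exact inv_anti₀ (by linarith) (by linarith [Real.add_one_le_exp (p * a)])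
    have h5 : p * a / (1 + M) ≤ p * a / (1 + p * a) :=
      div_le_div_of_nonneg_left hpa (by linarith) (by linarith)
    have h6 : p * a / (1 + p * a) = 1 - 1 / (1 + p * a) := by
      field_simp; ring
    linarith
  rw [e]
  calc _ = Real.exp (-(2 * M ^ 2)) * (p * a / (1 + M)) := by ring
    _ ≤ _ := mul_le_mul hA hB (by positivity) (by positivity)

/-- `newNbrs G {v} ∅` is the neighbourhood of v, so this is a Chernoff bound for its degree, with
2^X ≥ e^(X/2). -/
theorem real_le_card_newNbrs_singleton {n : ℕ} (p : unitInterval) (v : Fin n) :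
    (binomialRandom (Fin n) p).real {G | 8 * (n * (p : ℝ)) ≤ (newNbrs G {v} ∅).card} ≤
      Real.exp (-(3 * (n * (p : ℝ)))) := by
  have h0 := p.2.1
  have h1 := p.2.2
  rw [binomialRandom_real_eq_bernSum]
  have hE : Real.exp (1 / 2) ≤ 2 := by
    have h := Real.exp_one_lt_d9
    have h2 : Real.exp (1 / 2) ^ 2 = Real.exp 1 := by rw [← Real.exp_nat_mul]; norm_num
    nlinarith [Real.exp_pos (1 / 2)]
  calc _ ≤ bernSum (allEdges n) p (fun T => Real.exp (-(4 * (n * (p : ℝ)))) *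
        2 ^ (newNbrs (fromEdgeSet (T : Set (Sym2 (Fin n)))) {v} ∅).card) := by
        refine bernSum_mono h0 h1 fun T _ => ?_
        split_ifs with h
        · set X := (newNbrs (fromEdgeSet (T : Set (Sym2 (Fin n)))) {v} ∅).card
          have h2 : Real.exp (1 / 2) ^ X ≤ 2 ^ X := pow_le_pow_left₀ (Real.exp_pos _).le hE X
          rw [← Real.exp_nat_mul] at h2
          refine le_trans ?_ (mul_le_mul_of_nonneg_left h2 (Real.exp_pos _).le)
          rw [← Real.exp_add, Real.one_le_exp_iff]
          linarith
        · positivity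
    _ ≤ Real.exp (-(4 * (n * (p : ℝ)))) * (1 + (p : ℝ)) ^ n := by
        rw [bernSum_const_mul]
        refine mul_le_mul_of_nonneg_left ?_ (Real.exp_pos _).le
        refine (bernSum_pow_card_newNbrs_le (by simp) h0 h1 zero_le_two).trans ?_
        have e : (1 + ((2 : ℝ) - 1) * ((1 - (p : ℝ)) ^ (∅ : Finset (Fin n)).card -
            (1 - (p : ℝ)) ^ (({v} : Finset (Fin n)).card + (∅ : Finset (Fin n)).card))) = 1 + p := by
          simp; ring
        rw [e]
        refine pow_le_pow_right₀ (by linarith) ((Finset.card_le_univ _).trans_eq (by simp))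
    _ ≤ Real.exp (-(4 * (n * (p : ℝ)))) * Real.exp (n * p) := by
        refine mul_le_mul_of_nonneg_left ?_ (Real.exp_pos _).le
        rw [Real.exp_nat_mul]
        exact pow_le_pow_left₀ (by linarith) (by linarith [Real.add_one_le_exp (p : ℝ)]) n
    _ = _ := by rw [← Real.exp_add]; congr 1; ring

/-- The expansion rate for parameter `M`. -/
noncomputable def expansionRate (M : ℝ) : ℝ := Real.exp (-(2 * M ^ 2)) / (1 + M) / 8

theorem expansionRate_pos {M : ℝ} (hM : 0 ≤ M) : 0 < expansionRate M := by
  unfold expansionRate; positivity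

/-- Chernoff bound for the lower tail with z = 1/2. The 8 in `expansionRate` makes the mean at least
4t over the at least n/2 available vertices; this yields e^(-2t), and the threshold t gives back
e^t. -/
theorem real_card_newNbrs_le {n : ℕ} (p : unitInterval) {M : ℝ} (hM : 0 ≤ M)
    (hp : (p : ℝ) ≤ 1 / 2) {A W : Finset (Fin n)} (hAW : Disjoint A W)
    (hW : (W.card : ℝ) ≤ M * A.card) (hA : p * (A.card : ℝ) ≤ M)
    (hn : (n : ℝ) / 2 ≤ ((A ∪ W)ᶜ).card) :
    (binomialRandom (Fin n) p).real
        {G | ((newNbrs G A W).card : ℝ) ≤ expansionRate M * (n * p) * A.card} ≤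
      Real.exp (-(expansionRate M * (n * p) * A.card)) := by
  have h0 := p.2.1
  have h1 := p.2.2
  rw [binomialRandom_real_eq_bernSum]
  set t : ℝ := expansionRate M * (n * p) * A.card with ht
  set N := ((A ∪ W)ᶜ).card with hN
  set π : ℝ := (1 - (p : ℝ)) ^ W.card - (1 - (p : ℝ)) ^ (A.card + W.card) with hπ
  have hπ0 : 8 * expansionRate M * (p * A.card) ≤ π := by
    have := one_sub_pow_sub_ge h0 hp hM hW hA
    unfold expansionRate
    calc _ = Real.exp (-(2 * M ^ 2)) / (1 + M) * (p * A.card) := by ring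
      _ ≤ _ := this
  have hr := expansionRate_pos hM
  have hx : 0 ≤ 8 * expansionRate M * (p * A.card) := by positivity
  have hπ1 : π ≤ 1 := by
    have h2 : (1 - (p : ℝ)) ^ W.card ≤ 1 := pow_le_one₀ (by linarith) (by linarith)
    have h3 : 0 ≤ (1 - (p : ℝ)) ^ (A.card + W.card) := pow_nonneg (by linarith) _
    linarith
  have hE : Real.exp (-1) ≤ 1 / 2 := by
    rw [Real.exp_neg, one_div]
    exact inv_anti₀ two_pos (by linarith [Real.add_one_le_exp (1 : ℝ)])
  calc _ ≤ bernSum (allEdges n) p (fun T => Real.exp t *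
        (1 / 2) ^ (newNbrs (fromEdgeSet (T : Set (Sym2 (Fin n)))) A W).card) := by
        refine bernSum_mono h0 h1 fun T _ => ?_
        split_ifs with h
        · set X := (newNbrs (fromEdgeSet (T : Set (Sym2 (Fin n)))) A W).card
          have h2 : Real.exp (-1) ^ X ≤ (1 / 2) ^ X := pow_le_pow_left₀ (Real.exp_pos _).le hE X
          rw [← Real.exp_nat_mul] at h2
          refine le_trans ?_ (mul_le_mul_of_nonneg_left h2 (Real.exp_pos _).le)
          rw [← Real.exp_add, Real.one_le_exp_iff]
          linarith
        · positivity
    _ ≤ Real.exp t * (1 + (1 / 2 - 1) * π) ^ N := by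
        rw [bernSum_const_mul]
        exact mul_le_mul_of_nonneg_left (bernSum_pow_card_newNbrs_le hAW h0 h1 (by norm_num))
          (Real.exp_pos _).le
    _ ≤ Real.exp t * Real.exp (-(π / 2) * N) := by
        refine mul_le_mul_of_nonneg_left ?_ (Real.exp_pos _).le
        rw [mul_comm _ (N : ℝ), Real.exp_nat_mul]
        exact pow_le_pow_left₀ (by linarith) (by linarith [Real.add_one_le_exp (-(π / 2))]) N
    _ ≤ Real.exp t * Real.exp (-(2 * t)) := by
        refine mul_le_mul_of_nonneg_left (Real.exp_le_exp.2 ?_) (Real.exp_pos _).le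
        have h3 : (8 * expansionRate M * (p * A.card)) * (n / 2) ≤ π * N :=
          mul_le_mul hπ0 hn (by positivity) (hx.trans hπ0)
        have h4 : (8 * expansionRate M * (p * A.card)) * (n / 2) = 4 * t := by rw [ht]; ring
        linarith
    _ = _ := by rw [← Real.exp_add]; congr 1; ring

/-- All sets `A` with `p |A| ≤ M` expand, even when the neighbours of another set `W` that is not
much larger are removed. -/
def IsExpanding {n : ℕ} (G : SimpleGraph (Fin n)) (p M : ℝ) : Prop :=
  ∀ A W : Finset (Fin n), A.Nonempty → Disjoint A W → (W.card : ℝ) ≤ M * A.card →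
    p * (A.card : ℝ) ≤ M → expansionRate M * (n * p) * A.card ≤ (newNbrs G A W).card

theorem sum_pow_card_fin (n : ℕ) (z : ℝ) :
    ∑ A : Finset (Fin n), z ^ A.card = (1 + z) ^ n := by
  have h := Finset.prod_add (fun _ : Fin n => z) (fun _ => 1) Finset.univ
  simp only [Finset.prod_const, Finset.card_univ, Fintype.card_fin, Finset.powerset_univ,
    one_pow, mul_one] at h
  rw [← h, add_comm]

/-- Union bound over all pairs (A, W). The exponent c|A| is split into thirds: one is at least c/3
as A is nonempty, one pays for A, and one pays for W as |W| ≤ M|A|. The sum over pairs then factors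
by the binomial theorem. -/
theorem real_not_isExpanding_le {n : ℕ} (p : unitInterval) {M : ℝ} (hM : 1 ≤ M)
    (hp : (p : ℝ) ≤ 1 / 2) (hp0 : 0 < (p : ℝ)) (hn : 2 * M * (1 + M) ≤ n * p) :
    (binomialRandom (Fin n) p).real {G | ¬ IsExpanding G p M} ≤
      Real.exp (-(expansionRate M * (n * p) / 3)) *
        ((1 + Real.exp (-(expansionRate M * (n * p) / 3))) ^ n *
          (1 + Real.exp (-(expansionRate M * (n * p) / (3 * M)))) ^ n) := by
  have hM0 : 0 ≤ M := by linarith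
  set c : ℝ := expansionRate M * (n * p) with hc
  have hc0 : 0 ≤ c := by
    have := expansionRate_pos hM0
    positivity
  set I : Finset (Finset (Fin n) × Finset (Fin n)) := Finset.univ.filter fun z =>
    z.1.Nonempty ∧ Disjoint z.1 z.2 ∧ (z.2.card : ℝ) ≤ M * z.1.card ∧
      p * (z.1.card : ℝ) ≤ M with hI
  have hsub : {G : SimpleGraph (Fin n) | ¬ IsExpanding G p M} ⊆
      ⋃ z ∈ I, {G | ((newNbrs G z.1 z.2).card : ℝ) ≤ c * z.1.card} := by
    intro G hG
    simp only [Set.mem_ofPred_eq, IsExpanding, not_forall, not_le] at hG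
    obtain ⟨A, W, h1, h2, h3, h4, h5⟩ := hG
    simp only [Set.mem_iUnion]
    exact ⟨(A, W), by simp only [hI, Finset.mem_filter, Finset.mem_univ, true_and]; exact
      ⟨h1, h2, h3, h4⟩, h5.le⟩
  refine (MeasureTheory.measureReal_mono hsub (MeasureTheory.measure_ne_top _ _)).trans
    ((MeasureTheory.measureReal_biUnion_finset_le _ _).trans ?_)
  calc _ ≤ ∑ z ∈ I, Real.exp (-(c / 3)) * (Real.exp (-(c / 3)) ^ z.1.card *
        Real.exp (-(c / (3 * M))) ^ z.2.card) := by
        refine Finset.sum_le_sum fun z hz => ?_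
        simp only [hI, Finset.mem_filter, Finset.mem_univ, true_and] at hz
        obtain ⟨h1, h2, h3, h4⟩ := hz
        refine (real_card_newNbrs_le p hM0 hp h2 h3 h4 ?_).trans ?_
        · have e : (((z.1 ∪ z.2)ᶜ).card : ℝ) = n - (z.1.card + z.2.card) := by
            rw [Finset.card_compl, Nat.cast_sub (Finset.card_le_univ _),
              Finset.card_union_of_disjoint h2, Fintype.card_fin]
            push_cast; ring
          rw [e]
          -- This gives |A ∪ W| ≤ n/2.
          have h5 : p * (2 * (z.1.card + z.2.card : ℝ)) ≤ p * n := by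
            calc p * (2 * (z.1.card + z.2.card : ℝ)) ≤ p * (2 * (z.1.card + M * z.1.card)) := by
                  gcongr
              _ = 2 * (1 + M) * (p * z.1.card) := by ring
              _ ≤ 2 * (1 + M) * M := by gcongr
              _ ≤ p * n := by linarith
          have := le_of_mul_le_mul_left h5 hp0
          linarith
        · rw [← Real.exp_nat_mul, ← Real.exp_nat_mul, ← Real.exp_add, ← Real.exp_add,
            Real.exp_le_exp, ← hc]
          have h6 : (1 : ℝ) ≤ z.1.card := by exact_mod_cast h1.card_pos
          have h7 : c / (3 * M) * z.2.card ≤ c / 3 * z.1.card := by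
            calc c / (3 * M) * z.2.card ≤ c / (3 * M) * (M * z.1.card) := by gcongr
              _ = c / 3 * z.1.card := by field_simp
          nlinarith
    _ ≤ ∑ z : Finset (Fin n) × Finset (Fin n), Real.exp (-(c / 3)) *
        (Real.exp (-(c / 3)) ^ z.1.card * Real.exp (-(c / (3 * M))) ^ z.2.card) :=
        Finset.sum_le_sum_of_subset_of_nonneg (Finset.subset_univ _)
          fun _ _ _ => by positivity
    _ = _ := by
        rw [← Finset.mul_sum, ← sum_pow_card_fin, ← sum_pow_card_fin, Fintype.sum_prod_type,
          Finset.sum_mul_sum]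

theorem real_exists_le_card_newNbrs_singleton {n : ℕ} (p : unitInterval) :
    (binomialRandom (Fin n) p).real
        {G | ¬ ∀ v, ((newNbrs G {v} ∅).card : ℝ) ≤ 8 * (n * (p : ℝ))} ≤
      n * Real.exp (-(3 * (n * (p : ℝ)))) := by
  have hsub : {G : SimpleGraph (Fin n) | ¬ ∀ v, ((newNbrs G {v} ∅).card : ℝ) ≤ 8 * (n * (p : ℝ))} ⊆
      ⋃ v ∈ (Finset.univ : Finset (Fin n)),
        {G | 8 * (n * (p : ℝ)) ≤ (newNbrs G {v} ∅).card} := by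
    intro G hG
    simp only [Set.mem_ofPred_eq, not_forall, not_le] at hG
    obtain ⟨v, hv⟩ := hG
    simp only [Set.mem_iUnion]
    exact ⟨v, Finset.mem_univ _, hv.le⟩
  refine (MeasureTheory.measureReal_mono hsub (MeasureTheory.measure_ne_top _ _)).trans
    ((MeasureTheory.measureReal_biUnion_finset_le _ _).trans ?_)
  refine (Finset.sum_le_sum fun v _ => real_le_card_newNbrs_singleton p v).trans ?_
  simp

end Expansion

/-! ### Growth of the sets D_j from one distance to the next. -/

section BreadthFirst

open scoped Classical

theorem exists_adj_of_edist_eq_succ {V : Type*} {G : SimpleGraph V} {w u : V} {j : ℕ}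
    (h : G.edist w u = (j + 1 : ℕ)) : ∃ b, G.Adj b u ∧ G.edist w b ≤ j := by
  obtain ⟨P, hP⟩ := exists_walk_of_edist_eq_coe (edist_comm.trans h)
  cases P with
  | nil => simp at hP
  | @cons _ b _ hadj Q =>
    refine ⟨b, hadj.symm, ?_⟩
    rw [edist_comm]
    refine (edist_le Q).trans ?_
    have : Q.length = j := by simpa using hP
    rw [this]

/-- The ball of radius `j` around `v`. -/
noncomputable def distBall {n : ℕ} (G : SimpleGraph (Fin n)) (v : Fin n) (j : ℕ) :
    Finset (Fin n) :=
  Finset.univ.filter fun u => G.edist v u ≤ j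

theorem mem_distBall {n : ℕ} {G : SimpleGraph (Fin n)} {v u : Fin n} {j : ℕ} :
    u ∈ distBall G v j ↔ G.edist v u ≤ j := by
  simp [distBall]

theorem card_distBall_le {n : ℕ} {G : SimpleGraph (Fin n)} {Δ : ℝ}
    (h : ∀ v, ((newNbrs G {v} ∅).card : ℝ) ≤ Δ) (v : Fin n) (j : ℕ) :
    ((distBall G v j).card : ℝ) ≤ (1 + Δ) ^ j := by
  have hΔ : 0 ≤ Δ := (Nat.cast_nonneg _).trans (h v)
  induction j with
  | zero =>
    have : distBall G v 0 = {v} := by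
      ext u; simp [mem_distBall, edist_eq_zero_iff, eq_comm (a := u)]
    simp [this]
  | succ j ih =>
    have hsub : distBall G v (j + 1) ⊆
        distBall G v j ∪ (distBall G v j).biUnion fun b => newNbrs G {b} ∅ := by
      intro u hu
      rw [mem_distBall] at hu
      by_cases hj : u ∈ distBall G v j
      · exact Finset.mem_union_left _ hj
      · rw [mem_distBall, not_le] at hj
        have he : G.edist v u = (j + 1 : ℕ) :=
          le_antisymm hu (by push_cast; exact Order.add_one_le_of_lt hj)
        obtain ⟨b, hb, hb'⟩ := exists_adj_of_edist_eq_succ he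
        refine Finset.mem_union_right _ (Finset.mem_biUnion.2 ⟨b, mem_distBall.2 hb', ?_⟩)
        rw [mem_newNbrs]
        simpa using ⟨hb.ne', hb⟩
    have h1 : ((distBall G v (j + 1)).card : ℝ) ≤ (distBall G v j).card +
        ((distBall G v j).biUnion fun b => newNbrs G {b} ∅).card := by
      exact_mod_cast (Finset.card_le_card hsub).trans (Finset.card_union_le _ _)
    have h2 : (((distBall G v j).biUnion fun b => newNbrs G {b} ∅).card : ℝ) ≤
        (distBall G v j).card * Δ := by
      calc _ ≤ ((∑ b ∈ distBall G v j, (newNbrs G {b} ∅).card : ℕ) : ℝ) := by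
            exact_mod_cast Finset.card_biUnion_le
        _ ≤ _ := by
            push_cast
            rw [← nsmul_eq_mul]
            exact Finset.sum_le_card_nsmul _ _ _ fun b _ => h b
    calc _ ≤ ((distBall G v j).card : ℝ) * (1 + Δ) := by linarith
      _ ≤ (1 + Δ) ^ j * (1 + Δ) := mul_le_mul_of_nonneg_right ih (by linarith)
      _ = _ := (pow_succ _ _).symm

/-- A new neighbour u lies outside both balls and next to D_j, hence at distance j+1 from v. Were it
at distance j+1 from w too, the preceding vertex on a shortest path from w would lie in the ball
around w but not in D_j, hence in the forbidden set. -/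
theorem newNbrs_distDiff_subset {n : ℕ} (G : SimpleGraph (Fin n)) (v w : Fin n) (j : ℕ) :
    newNbrs G (distDiff G v w j) ((distBall G v j ∪ distBall G w j) \ distDiff G v w j) ⊆
      distDiff G v w (j + 1) := by
  intro u hu
  rw [mem_newNbrs] at hu
  obtain ⟨h1, ⟨a, ha, hau⟩, h3⟩ := hu
  have hu' : u ∉ distBall G v j ∧ u ∉ distBall G w j := by
    simp only [Finset.mem_compl, Finset.mem_union, Finset.mem_sdiff] at h1
    tauto
  obtain ⟨hv, hw⟩ := hu'
  rw [mem_distBall, not_le] at hv hw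
  have hv' := Order.add_one_le_of_lt hv
  have hw' := Order.add_one_le_of_lt hw
  have ha' := mem_distDiff.1 ha
  rw [mem_distDiff]
  constructor
  · push_cast
    refine le_antisymm ?_ hv'
    refine (SimpleGraph.edist_triangle (v := a)).trans ?_
    rw [ha'.1, edist_eq_one_iff_adj.2 hau]
  · refine lt_of_le_of_ne (by exact_mod_cast hw') fun he => ?_
    obtain ⟨b, hb, hb'⟩ := exists_adj_of_edist_eq_succ he.symm
    refine h3 b ?_ hb
    simp only [Finset.mem_sdiff, Finset.mem_union, mem_distBall, mem_distDiff]
    exact ⟨Or.inr hb', fun h => absurd h.2 (not_lt.2 hb')⟩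

/-- The balls have at most (1 + 8np)^j ≤ (9np)^j vertices. So `hM` makes the forbidden set at most M
times as large as D_j, and `hpM` gives p|D_j| ≤ M, as expansion requires. -/
theorem card_distDiff_succ_ge {n : ℕ} {G : SimpleGraph (Fin n)} {p M c : ℝ} {j : ℕ}
    (hp : 0 ≤ p) (hdeg : ∀ v, ((newNbrs G {v} ∅).card : ℝ) ≤ 8 * (n * p)) (hnp : 1 ≤ n * p)
    (hG : IsExpanding G p M) (hc : 0 < c) (hM : 2 * 9 ^ j ≤ M * c)
    (hpM : p * (9 * (n * p)) ^ j ≤ M) {v w : Fin n}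
    (hD : c * (n * p) ^ j ≤ (distDiff G v w j).card) :
    expansionRate M * c * (n * p) ^ (j + 1) ≤ (distDiff G v w (j + 1)).card := by
  have hball : ∀ u, ((distBall G u j).card : ℝ) ≤ (9 * (n * p)) ^ j := fun u =>
    (card_distBall_le hdeg u j).trans (pow_le_pow_left₀ (by linarith) (by linarith) j)
  have hM0 : 0 ≤ M := by
    have : 0 < M * c := lt_of_lt_of_le (by positivity) hM
    exact (pos_of_mul_pos_left this hc.le).le
  have hpos : 0 < c * (n * p) ^ j := by positivity
  have hcard : (0 : ℝ) < (distDiff G v w j).card := hpos.trans_le hD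
  have hDB : distDiff G v w j ⊆ distBall G v j := fun u hu =>
    mem_distBall.2 (mem_distDiff.1 hu).1.le
  have h := hG (distDiff G v w j) ((distBall G v j ∪ distBall G w j) \ distDiff G v w j)
    (Finset.card_pos.1 (by exact_mod_cast hcard)) Finset.disjoint_sdiff ?_ ?_
  · have h2 : ((newNbrs G (distDiff G v w j)
        ((distBall G v j ∪ distBall G w j) \ distDiff G v w j)).card : ℝ) ≤
        (distDiff G v w (j + 1)).card := by
      exact_mod_cast Finset.card_le_card (newNbrs_distDiff_subset G v w j)
    refine le_trans ?_ (h.trans h2)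
    have := expansionRate_pos hM0
    calc _ = expansionRate M * (n * p) * (c * (n * p) ^ j) := by ring
      _ ≤ _ := by gcongr
  · have h3 : (((distBall G v j ∪ distBall G w j) \ distDiff G v w j).card : ℝ) ≤
        (distBall G v j).card + (distBall G w j).card := by
      exact_mod_cast (Finset.card_le_card Finset.sdiff_subset).trans (Finset.card_union_le _ _)
    calc _ ≤ (9 * (n * p)) ^ j + (9 * (n * p)) ^ j := h3.trans (add_le_add (hball v) (hball w))
      _ = 2 * 9 ^ j * (n * p) ^ j := by rw [mul_pow]; ring
      _ ≤ M * c * (n * p) ^ j := by gcongr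
      _ = M * (c * (n * p) ^ j) := by ring
      _ ≤ _ := by gcongr
  · refine le_trans (mul_le_mul_of_nonneg_left ?_ hp) hpM
    refine le_trans ?_ (hball v)
    exact_mod_cast Finset.card_le_card hDB

end BreadthFirst

/-! ### Limits in n, and the size of D_i with high probability. -/

section Asymptotics

/-- The expected degrees are, up to constant factors, equal to `n ^ x`. -/
def NearPow (x K : ℝ) (p : ℕ → unitInterval) : Prop :=
  ∀ᶠ n : ℕ in atTop, Real.exp (-K) * (n : ℝ) ^ x ≤ n * (p n : ℝ) ∧
    n * (p n : ℝ) ≤ 2 * Real.exp K * (n : ℝ) ^ x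

theorem tendsto_natCast_rpow_atTop {x : ℝ} (hx : 0 < x) :
    Tendsto (fun n : ℕ => (n : ℝ) ^ x) atTop atTop :=
  (tendsto_rpow_atTop hx).comp tendsto_natCast_atTop_atTop

theorem nearPow_of_eq_rpow {x K : ℝ} {p : ℕ → unitInterval} {δ : ℕ → ℝ}
    (hδ : ∀ᶠ n : ℕ in atTop, |δ n| ≤ K / Real.log n)
    (hp : ∀ᶠ n : ℕ in atTop, ((n : ℝ) - 1) * (p n : ℝ) = (n : ℝ) ^ (x + δ n)) :
    NearPow x K p := by
  filter_upwards [hδ, hp, eventually_ge_atTop 2] with n h1 h2 h3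
  have hn : (2 : ℝ) ≤ n := by exact_mod_cast h3
  have hn0 : (0 : ℝ) < n := by linarith
  have hlog : 0 < Real.log n := Real.log_pos (by linarith)
  rw [le_div_iff₀ hlog] at h1
  have habs : |Real.log n * δ n| ≤ K := by rwa [abs_mul, abs_of_pos hlog, mul_comm]
  have hb := abs_le.1 habs
  rw [Real.rpow_add hn0, Real.rpow_def_of_pos hn0 (δ n)] at h2
  have hx : 0 < (n : ℝ) ^ x := Real.rpow_pos_of_pos hn0 x
  have e1 := Real.exp_le_exp.2 hb.1
  have e2 := Real.exp_le_exp.2 hb.2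
  have hp0 := (p n).2.1
  constructor
  · calc _ ≤ (n : ℝ) ^ x * Real.exp (Real.log n * δ n) := by
          rw [mul_comm]; exact mul_le_mul_of_nonneg_left e1 hx.le
      _ ≤ _ := by rw [← h2]; nlinarith
  -- The factor 2 absorbs n ≤ 2(n - 1).
  · calc _ ≤ 2 * (((n : ℝ) - 1) * (p n : ℝ)) := by nlinarith
      _ ≤ _ := by
        rw [h2]
        have := mul_le_mul_of_nonneg_left e2 hx.le
        linarith

variable {x K : ℝ} {p : ℕ → unitInterval}

theorem NearPow.mono {K' : ℝ} (h : NearPow x K p) (hK : K ≤ K') : NearPow x K' p := by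
  filter_upwards [h] with n hn
  have hx : 0 ≤ (n : ℝ) ^ x := Real.rpow_nonneg (Nat.cast_nonneg _) x
  have h1 : Real.exp (-K') ≤ Real.exp (-K) := Real.exp_le_exp.2 (by linarith)
  have h2 : Real.exp K ≤ Real.exp K' := Real.exp_le_exp.2 hK
  refine ⟨le_trans (mul_le_mul_of_nonneg_right h1 hx) hn.1, hn.2.trans ?_⟩
  gcongr

theorem NearPow.tendsto_atTop (h : NearPow x K p) (hx : 0 < x) :
    Tendsto (fun n : ℕ => n * (p n : ℝ)) atTop atTop :=
  tendsto_atTop_mono' _ (Filter.Eventually.mono h fun _ hn => hn.1)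
    ((tendsto_natCast_rpow_atTop hx).const_mul_atTop (Real.exp_pos _))

/-- Since np is at least a constant times t = n^x, this reduces to t^(1/x) e^(-bt) → 0. It pays for
the union bounds. -/
theorem NearPow.tendsto_mul_exp (h : NearPow x K p) (hx : 0 < x) {c : ℝ} (hc : 0 < c) :
    Tendsto (fun n : ℕ => n * Real.exp (-(c * (n * (p n : ℝ))))) atTop (𝓝 0) := by
  set b := c * Real.exp (-K) with hb
  have hb0 : 0 < b := by positivity
  have h2 : Tendsto (fun t : ℝ => t ^ (1 / x) * Real.exp (-b * t)) atTop (𝓝 0) :=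
    tendsto_rpow_mul_exp_neg_mul_atTop_nhds_zero _ _ hb0
  have h3 := h2.comp (tendsto_natCast_rpow_atTop hx)
  refine squeeze_zero' (Eventually.of_forall fun n => by positivity) ?_ h3
  filter_upwards [h] with n hn
  have e : ((n : ℝ) ^ x) ^ (1 / x) = n := by
    rw [← Real.rpow_mul (Nat.cast_nonneg _), mul_one_div_cancel hx.ne', Real.rpow_one]
  simp only [Function.comp, e]
  refine mul_le_mul_of_nonneg_left (Real.exp_le_exp.2 ?_) (Nat.cast_nonneg _)
  have := mul_le_mul_of_nonneg_left hn.1 hc.le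
  rw [hb]; linarith

/-- The left side is (np)^(j+1)/n. It stays bounded even when (j+1)x = 1, which lets the induction
reach i = ⌊1/x⌋. -/
theorem NearPow.mul_pow_le (h : NearPow x K p) {j : ℕ} (hj : (j + 1 : ℕ) * x ≤ 1) :
    ∀ᶠ n : ℕ in atTop, (p n : ℝ) * (n * (p n : ℝ)) ^ j ≤ (2 * Real.exp K) ^ (j + 1) := by
  filter_upwards [h, eventually_ge_atTop 1] with n hn h1
  have hn1 : (1 : ℝ) ≤ n := by exact_mod_cast h1
  have hn0 : (0 : ℝ) < n := by linarith
  have hp0 := (p n).2.1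
  refine le_of_mul_le_mul_left ?_ hn0
  calc (n : ℝ) * ((p n : ℝ) * (n * (p n : ℝ)) ^ j) = (n * (p n : ℝ)) ^ (j + 1) := by ring
    _ ≤ (2 * Real.exp K * (n : ℝ) ^ x) ^ (j + 1) := pow_le_pow_left₀ (by positivity) hn.2 _
    _ = (2 * Real.exp K) ^ (j + 1) * (n : ℝ) ^ ((j + 1 : ℕ) * x) := by
        rw [mul_pow, mul_comm ((j + 1 : ℕ) : ℝ) x, Real.rpow_mul hn0.le, Real.rpow_natCast]
    _ ≤ (2 * Real.exp K) ^ (j + 1) * (n : ℝ) ^ (1 : ℝ) := by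
        gcongr
    _ = _ := by rw [Real.rpow_one]; ring

theorem NearPow.tendsto_zero (h : NearPow x K p) (hx1 : x < 1) :
    Tendsto (fun n => (p n : ℝ)) atTop (𝓝 0) := by
  have h1 : Tendsto (fun n : ℕ => 2 * Real.exp K * (n : ℝ) ^ (-(1 - x))) atTop (𝓝 0) := by
    have := ((tendsto_rpow_neg_atTop (sub_pos.2 hx1)).comp
      (tendsto_natCast_atTop_atTop (R := ℝ))).const_mul (2 * Real.exp K)
    simpa using this
  refine squeeze_zero' (Eventually.of_forall fun n => (p n).2.1) ?_ h1
  filter_upwards [h, eventually_ge_atTop 1] with n hn h1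
  have hn0 : (0 : ℝ) < n := by exact_mod_cast h1
  refine le_of_mul_le_mul_left ?_ hn0
  refine hn.2.trans (le_of_eq ?_)
  have e : (n : ℝ) * (n : ℝ) ^ (-(1 - x)) = (n : ℝ) ^ x := by
    conv_rhs => rw [show x = 1 + -(1 - x) by ring, Real.rpow_add hn0, Real.rpow_one]
  rw [← e]; ring

theorem NearPow.tendsto_not_isExpanding (h : NearPow x K p) (hx0 : 0 < x) (hx1 : x < 1) {M : ℝ}
    (hM : 1 ≤ M) :
    Tendsto (fun n => (binomialRandom (Fin n) (p n)).real {G | ¬ IsExpanding G (p n) M})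
      atTop (𝓝 0) := by
  have hM0 : 0 < M := by linarith
  have hr := expansionRate_pos hM0.le
  have hlim : ∀ c : ℝ, 0 < c → Tendsto (fun n : ℕ => n * Real.exp (-(c * (n * (p n : ℝ)))))
      atTop (𝓝 0) := fun c hc => h.tendsto_mul_exp hx0 hc
  have h1 : Tendsto (fun n : ℕ => Real.exp (-(expansionRate M / 3 * (n * (p n : ℝ)))))
      atTop (𝓝 0) :=
    Real.tendsto_exp_neg_atTop_nhds_zero.comp
      ((h.tendsto_atTop hx0).const_mul_atTop (by positivity))
  have h2 := (Real.continuous_exp.tendsto 0).comp (hlim (expansionRate M / 3) (by positivity))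
  have h3 := (Real.continuous_exp.tendsto 0).comp
    (hlim (expansionRate M / (3 * M)) (by positivity))
  have h4 := h1.mul (h2.mul h3)
  rw [zero_mul] at h4
  refine squeeze_zero' (Eventually.of_forall fun n => MeasureTheory.measureReal_nonneg) ?_ h4
  filter_upwards [(h.tendsto_zero hx1).eventually_le_const (by norm_num : (0 : ℝ) < 1 / 2),
    (h.tendsto_atTop hx0).eventually_ge_atTop (2 * M * (1 + M))] with n hp hnp
  have hp0 : 0 < (p n : ℝ) := by
    have h5 : 0 < 2 * M * (1 + M) := by positivity
    exact pos_of_mul_pos_right (h5.trans_le hnp) (Nat.cast_nonneg _)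
  refine (real_not_isExpanding_le (p n) hM hp hp0 hnp).trans ?_
  have hz : ∀ z : ℝ, 0 ≤ z → (1 + z) ^ n ≤ Real.exp (n * z) := by
    intro z hz
    rw [Real.exp_nat_mul]
    exact pow_le_pow_left₀ (by linarith) (by linarith [Real.add_one_le_exp z]) n
  have e1 : expansionRate M * (n * (p n : ℝ)) / 3 = expansionRate M / 3 * (n * (p n : ℝ)) := by
    ring
  have e2 : expansionRate M * (n * (p n : ℝ)) / (3 * M) =
      expansionRate M / (3 * M) * (n * (p n : ℝ)) := by ring
  rw [e1, e2]
  simp only [Function.comp]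
  gcongr
  · exact hz _ (Real.exp_pos _).le
  · exact hz _ (Real.exp_pos _).le

theorem NearPow.tendsto_exists_lt_degree (h : NearPow x K p) (hx0 : 0 < x) :
    Tendsto (fun n => (binomialRandom (Fin n) (p n)).real
      {G | ¬ ∀ v, ((newNbrs G {v} ∅).card : ℝ) ≤ 8 * (n * (p n : ℝ))}) atTop (𝓝 0) :=
  squeeze_zero (fun _ => MeasureTheory.measureReal_nonneg)
    (fun n => real_exists_le_card_newNbrs_singleton (p n))
    (h.tendsto_mul_exp hx0 three_pos)

/-- With high probability, all the sets `distDiff G v w i` with `i ≤ j` have the expected order of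
magnitude. -/
theorem exists_tendsto_card_distDiff (hx0 : 0 < x) (hx1 : x < 1) (K : ℝ) (j : ℕ)
    (hj : j * x ≤ 1) :
    ∃ c : ℝ, 0 < c ∧ ∀ p : ℕ → unitInterval, NearPow x K p →
      Tendsto (fun n => (binomialRandom (Fin n) (p n)).real
        {G | ¬ ∀ i ≤ j, ∀ v w, v ≠ w → c * (n * (p n : ℝ)) ^ i ≤ (distDiff G v w i).card})
        atTop (𝓝 0) := by
  induction j with
  | zero =>
    refine ⟨1, one_pos, fun p _ => ?_⟩
    have : ∀ n, {G : SimpleGraph (Fin n) | ¬ ∀ i ≤ 0, ∀ v w, v ≠ w →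
        1 * (n * (p n : ℝ)) ^ i ≤ (distDiff G v w i).card} = ∅ := by
      intro n
      ext G
      simp only [Set.mem_ofPred_eq, Set.mem_empty_iff_false, iff_false, not_not]
      intro i hi v w hvw
      obtain rfl : i = 0 := by omega
      have hv : v ∈ distDiff G v w 0 := by
        rw [mem_distDiff]
        refine ⟨by simp, ?_⟩
        rw [Nat.cast_zero, pos_iff_ne_zero, Ne, edist_eq_zero_iff]
        exact hvw.symm
      have : 0 < (distDiff G v w 0).card := Finset.card_pos.2 ⟨v, hv⟩
      simpa using this
    simp only [this, MeasureTheory.measureReal_empty, tendsto_const_nhds]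
  | succ j ih =>
    obtain ⟨c, hc, hcp⟩ := ih (le_trans (by push_cast; linarith) hj)
    -- M meets the two size conditions of `card_distDiff_succ_ge`. It depends on c, K and j but not
    -- on p, so the resulting constant is uniform in p.
    set M : ℝ := max 1 (max (2 * 9 ^ j / c) (9 ^ j * (2 * Real.exp K) ^ (j + 1))) with hM
    have hM1 : 1 ≤ M := le_max_left _ _
    have hM2 : 2 * 9 ^ j / c ≤ M := (le_max_left _ _).trans (le_max_right _ _)
    have hM3 : 9 ^ j * (2 * Real.exp K) ^ (j + 1) ≤ M := (le_max_right _ _).trans (le_max_right _ _)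
    have hr := expansionRate_pos (zero_le_one.trans hM1)
    refine ⟨min c (expansionRate M * c), by positivity, fun p hp => ?_⟩
    have hlim := (hcp p hp).add ((hp.tendsto_exists_lt_degree hx0).add
      (hp.tendsto_not_isExpanding hx0 hx1 hM1))
    simp only [add_zero] at hlim
    refine squeeze_zero' (Eventually.of_forall fun n => MeasureTheory.measureReal_nonneg) ?_ hlim
    filter_upwards [hp.mul_pow_le hj, (hp.tendsto_atTop hx0).eventually_ge_atTop 1] with n h1 h2
    refine le_trans (MeasureTheory.measureReal_mono ?_ (MeasureTheory.measure_ne_top _ _))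
      ((MeasureTheory.measureReal_union_le _ _).trans
        (add_le_add le_rfl (MeasureTheory.measureReal_union_le _ _)))
    intro G hG
    by_contra hcon
    simp only [Set.mem_union, Set.mem_ofPred_eq, not_or, not_not] at hcon
    obtain ⟨hg, hdeg, hexp⟩ := hcon
    refine hG fun i hi v w hvw => ?_
    rcases Nat.lt_or_ge j i with hji | hij
    · obtain rfl : i = j + 1 := by omega
      refine le_trans ?_ (card_distDiff_succ_ge (p n).2.1 hdeg h2 hexp hc ?_ ?_
        (hg j le_rfl v w hvw))
      · exact mul_le_mul_of_nonneg_right (min_le_right _ _) (by positivity)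
      · rwa [div_le_iff₀ hc] at hM2
      · refine le_trans ?_ hM3
        rw [mul_pow]
        calc _ = 9 ^ j * ((p n : ℝ) * (n * (p n : ℝ)) ^ j) := by ring
          _ ≤ _ := by gcongr
    · exact le_trans (mul_le_mul_of_nonneg_right (min_le_left _ _) (by positivity))
        (hg i hij v w hvw)

end Asymptotics

/-! ### The equation f_x(y) = 4. -/

section ExpFun

variable {x : ℝ}

/-- Positivity excludes the initial interval where f_x vanishes; beyond it some summand is active
and strictly increases. -/
theorem expFun_lt_expFun {y y' : ℝ} (hy : 0 < expFun x y) (h : y < y') :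
    expFun x y < expFun x y' := by
  obtain ⟨i, hi, hpos⟩ := Finset.exists_lt_of_sum_lt (s := Finset.range (⌊1 / x⌋₊ + 1))
    (f := fun _ => (0 : ℝ)) (g := fun i : ℕ => max ((i : ℝ) * x + y - 1) 0)
    (by rw [Finset.sum_const_zero]; exact hy)
  refine Finset.sum_lt_sum (fun j _ => max_le_max_right _ (by linarith)) ⟨i, hi, ?_⟩
  have : 0 < (i : ℝ) * x + y - 1 := by simpa using hpos
  exact max_lt_max_left_iff.2 ⟨by linarith, by linarith⟩

theorem mul_le_one_of_le_floor (hx0 : 0 < x) {i : ℕ} (hi : i ≤ ⌊1 / x⌋₊) : (i : ℝ) * x ≤ 1 := by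
  have h1 : (i : ℝ) ≤ 1 / x :=
    (Nat.cast_le.2 hi).trans (Nat.floor_le (by positivity))
  rwa [le_div_iff₀ hx0] at h1

theorem expFun_zero (hx0 : 0 < x) : expFun x 0 = 0 := by
  refine Finset.sum_eq_zero fun i hi => ?_
  have := mul_le_one_of_le_floor hx0 (Nat.lt_succ_iff.1 (Finset.mem_range.1 hi))
  exact max_eq_right (by linarith)

/-- With k = ⌊1/x⌋ the value is x k(k+1)/2, and x(k+1) > 1 while k ≥ 8. -/
theorem four_lt_expFun_one (hx0 : 0 < x) (hx : x ≤ 1 / 8) : 4 < expFun x 1 := by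
  have e : expFun x 1 = x * ∑ i ∈ Finset.range (⌊1 / x⌋₊ + 1), (i : ℝ) := by
    rw [expFun, Finset.mul_sum]
    refine Finset.sum_congr rfl fun i _ => ?_
    rw [add_sub_cancel_right, mul_comm]
    exact max_eq_left (by positivity)
  have hsum : (∑ i ∈ Finset.range (⌊1 / x⌋₊ + 1), (i : ℝ)) * 2 = (⌊1 / x⌋₊ + 1) * ⌊1 / x⌋₊ := by
    have := Finset.sum_range_id_mul_two (⌊1 / x⌋₊ + 1)
    rw [Nat.add_sub_cancel] at this
    have h := congrArg (Nat.cast : ℕ → ℝ) this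
    push_cast at h
    exact h
  have h8 : (8 : ℝ) ≤ ⌊1 / x⌋₊ := by
    have : 8 ≤ ⌊1 / x⌋₊ := Nat.le_floor (by
      rw [le_div_iff₀ hx0]; push_cast; linarith)
    exact_mod_cast this
  have h1 : 1 < x * (⌊1 / x⌋₊ + 1) := by
    have := Nat.lt_floor_add_one (1 / x)
    rwa [div_lt_iff₀ hx0, mul_comm] at this
  rw [e]
  nlinarith

theorem existsUnique_expFun_eq_four (hx0 : 0 < x) (hx : x ≤ 1 / 8) :
    ∃! y : ℝ, y ∈ Set.Ioo (0 : ℝ) 1 ∧ expFun x y = 4 := by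
  have hcont : Continuous (expFun x) := by unfold expFun; fun_prop
  obtain ⟨y, hy, hy4⟩ := intermediate_value_Ioo zero_le_one hcont.continuousOn
    (show (4 : ℝ) ∈ Set.Ioo (expFun x 0) (expFun x 1) from
      ⟨by rw [expFun_zero hx0]; norm_num, four_lt_expFun_one hx0 hx⟩)
  refine ⟨y, ⟨hy, hy4⟩, fun z hz => ?_⟩
  rcases lt_trichotomy z y with h | h | h
  · have := expFun_lt_expFun (by rw [hz.2]; norm_num) h
    rw [hz.2, hy4] at this
    exact absurd this (lt_irrefl _)
  · exact h
  · have := expFun_lt_expFun (by rw [hy4]; norm_num) h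
    rw [hz.2, hy4] at this
    exact absurd this (lt_irrefl _)

theorem sum_filter_pos_eq_expFun (y : ℝ) :
    ∑ i ∈ (Finset.range (⌊1 / x⌋₊ + 1)).filter (fun i : ℕ => 0 < (i : ℝ) * x + y - 1),
      ((i : ℝ) * x + y - 1) = expFun x y := by
  rw [expFun, Finset.sum_filter]
  refine Finset.sum_congr rfl fun i _ => ?_
  split_ifs with h
  · exact (max_eq_left h.le).symm
  · exact (max_eq_right (not_lt.1 h)).symm

end ExpFun

/-! ### Choice of q and conclusion. -/

/-- A graph in which all the sets `distDiff G v w i` have size at least `c * n ^ (i * x)` has a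
small multiset resolving set. -/
theorem exists_isMultisetResolving_of_card_distDiff {n : ℕ} {x y c : ℝ} (hn : 2 ≤ n)
    (hc : 0 < c) (hy : expFun x y = 4) (hq : 16 / c * (n : ℝ) ^ (y - 1) ≤ 1 / 2)
    {G : SimpleGraph (Fin n)}
    (hG : ∀ i ≤ ⌊1 / x⌋₊, ∀ v w, v ≠ w → c * (n : ℝ) ^ (i * x) ≤ (distDiff G v w i).card) :
    ∃ R : Finset (Fin n), IsMultisetResolving G R ∧
      (R.card : ℝ) ≤ (n : ℝ) ^ (y + Real.log (32 / c) / Real.log n) := by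
  have hn2 : (2 : ℝ) ≤ n := by exact_mod_cast hn
  have hn0 : (0 : ℝ) < n := by linarith
  have : Nonempty (Fin n) := ⟨⟨0, by omega⟩⟩
  set I := (Finset.range (⌊1 / x⌋₊ + 1)).filter (fun i : ℕ => 0 < (i : ℝ) * x + y - 1) with hI
  -- The 16/c in q turns each factor into 1/4 times a power of n. One such 1/4 is what the first
  -- moment bound needs, hence `hne` below.
  have hterm : ∀ i : ℕ, 1 / Real.sqrt (16 / c * (n : ℝ) ^ (y - 1) * (c * (n : ℝ) ^ (i * x))) =
      1 / 4 * (n : ℝ) ^ (-(1 / 2) * (i * x + y - 1)) := by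
    intro i
    have e1 : 16 / c * (n : ℝ) ^ (y - 1) * (c * (n : ℝ) ^ (i * x)) =
        4 ^ 2 * (n : ℝ) ^ (i * x + y - 1) := by
      rw [show (i : ℝ) * x + y - 1 = (y - 1) + i * x by ring, Real.rpow_add hn0]
      field_simp; norm_num
    rw [e1, Real.sqrt_mul (by norm_num), Real.sqrt_sq (by norm_num), Real.sqrt_eq_rpow,
      ← Real.rpow_mul hn0.le, show -(1 / 2) * ((i : ℝ) * x + y - 1) =
        -((i * x + y - 1) * (1 / 2)) by ring, Real.rpow_neg hn0.le]
    field_simp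
  have hne : I.Nonempty := by
    rw [Finset.nonempty_iff_ne_empty]
    intro h
    have := sum_filter_pos_eq_expFun (x := x) y
    rw [← hI, h, hy] at this
    norm_num at this
  obtain ⟨R, hR, hcard⟩ := exists_isMultisetResolving G (I := I)
    (q := 16 / c * (n : ℝ) ^ (y - 1)) (b := fun i => c * (n : ℝ) ^ (i * x)) (by positivity) hq
    (fun i _ => by positivity)
    (fun v w hvw i hi => hG i
      (Nat.lt_succ_iff.1 (Finset.mem_range.1 (Finset.mem_filter.1 hi).1)) v w hvw) (by
      simp only [hterm]
      rw [Finset.prod_mul_distrib, Finset.prod_const, ← Real.rpow_sum_of_pos hn0,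
        ← Finset.mul_sum, sum_filter_pos_eq_expFun, hy, Fintype.card_fin,
        show -(1 / 2) * (4 : ℝ) = -(2 : ℕ) by norm_num, Real.rpow_neg hn0.le, Real.rpow_natCast]
      have h4 : (1 / 4 : ℝ) ^ I.card ≤ (1 / 4) ^ 1 :=
        pow_le_pow_of_le_one (by norm_num) (by norm_num) hne.card_pos
      have e : (n : ℝ) ^ 2 * ((1 / 4) ^ I.card * ((n : ℝ) ^ 2)⁻¹) = (1 / 4) ^ I.card := by
        field_simp
      rw [e]; simpa using h4)
  -- Twice the expected size is 2qn = (32/c) n^y, and the constant is n^(log(32/c)/log n).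
  refine ⟨R, hR, hcard.trans (le_of_eq ?_)⟩
  have hlog : Real.log n ≠ 0 := (Real.log_pos (by linarith)).ne'
  rw [Fintype.card_fin, Real.rpow_add hn0, Real.rpow_sub hn0, Real.rpow_one,
    Real.rpow_def_of_pos hn0 (Real.log (32 / c) / Real.log n), mul_div_cancel₀ _ hlog,
    Real.exp_log (by positivity)]
  field_simp; norm_num

theorem mainTheorem1 (x : ℝ) (hx0 : 0 < x) (hx : x ≤ 1 / 8) :
    (∃! y : ℝ, y ∈ Set.Ioo (0 : ℝ) 1 ∧ expFun x y = 4) ∧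
    ∀ y₄ : ℝ, y₄ ∈ Set.Ioo (0 : ℝ) 1 → expFun x y₄ = 4 →
      ∀ K : ℝ, ∃ C : ℝ, ∀ (p : ℕ → unitInterval) (δ : ℕ → ℝ),
        (∀ᶠ n : ℕ in atTop, |δ n| ≤ K / Real.log n) →
        (∀ᶠ n : ℕ in atTop, ((n : ℝ) - 1) * (p n : ℝ) = (n : ℝ) ^ (x + δ n)) →
        Tendsto
          (fun n : ℕ => SimpleGraph.binomialRandom (Fin n) (p n)
            {G : SimpleGraph (Fin n) | ∃ R : Finset (Fin n), IsMultisetResolving G R ∧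
              (R.card : ℝ) ≤ (n : ℝ) ^ (y₄ + C / Real.log n)})
          atTop (𝓝 1) := by
  refine ⟨existsUnique_expFun_eq_four hx0 hx, fun y hy hy4 K => ?_⟩
  set k := ⌊1 / x⌋₊ with hk
  obtain ⟨c, hc, hcp⟩ := exists_tendsto_card_distDiff hx0 (by linarith) |K| k
    (mul_le_one_of_le_floor hx0 le_rfl)
  -- The factor converts (np)^i into n^(ix) for all i ≤ k at once; using |K| makes its base at most
  -- 1, so i = k is the worst case.
  set c' : ℝ := c * Real.exp (-|K|) ^ k with hc'
  have hc'0 : 0 < c' := by positivity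
  refine ⟨Real.log (32 / c'), fun p δ hδ hp => ?_⟩
  have hnear : NearPow x |K| p := (nearPow_of_eq_rpow hδ hp).mono (le_abs_self K)
  have hq : ∀ᶠ n : ℕ in atTop, 16 / c' * (n : ℝ) ^ (y - 1) ≤ 1 / 2 := by
    have h1 := ((tendsto_rpow_neg_atTop (sub_pos.2 hy.2)).comp
      (tendsto_natCast_atTop_atTop (R := ℝ))).const_mul (16 / c')
    rw [mul_zero] at h1
    filter_upwards [h1.eventually_le_const (by norm_num : (0 : ℝ) < 1 / 2)] with n hn
    simpa using hn
  have hlim := (hcp p hnear).const_sub 1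
  rw [sub_zero] at hlim
  have hlim' := ENNReal.tendsto_ofReal hlim
  rw [ENNReal.ofReal_one] at hlim'
  refine tendsto_of_tendsto_of_tendsto_of_le_of_le' hlim' tendsto_const_nhds ?_
    (Eventually.of_forall fun n => MeasureTheory.prob_le_one)
  filter_upwards [hnear, hq, eventually_ge_atTop 2] with n hn hqn hn2
  rw [← MeasureTheory.ofReal_measureReal]
  refine ENNReal.ofReal_le_ofReal ?_
  rw [sub_le_iff_le_add]
  have hn0 : (0 : ℝ) ≤ n := Nat.cast_nonneg n
  calc (1 : ℝ) = (binomialRandom (Fin n) (p n)).real Set.univ := by simp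
    _ ≤ _ := MeasureTheory.measureReal_mono ?_ (MeasureTheory.measure_ne_top _ _)
    _ ≤ _ := MeasureTheory.measureReal_union_le _ _
  intro G _
  by_cases hG : ∀ i ≤ k, ∀ v w, v ≠ w → c * (n * (p n : ℝ)) ^ i ≤ (distDiff G v w i).card
  · refine Or.inl (exists_isMultisetResolving_of_card_distDiff hn2 hc'0 hy4 hqn
      fun i hi v w hvw => le_trans ?_ (hG i hi v w hvw))
    have h1 : Real.exp (-|K|) ^ k ≤ Real.exp (-|K|) ^ i :=
      pow_le_pow_of_le_one (Real.exp_pos _).le (Real.exp_le_one_iff.2 (by simp)) hi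
    calc c' * (n : ℝ) ^ (i * x) ≤ c * (Real.exp (-|K|) ^ i * ((n : ℝ) ^ x) ^ i) := by
          rw [hc', mul_assoc, mul_comm (i : ℝ) x, Real.rpow_mul hn0, Real.rpow_natCast]
          gcongr
      _ = c * (Real.exp (-|K|) * (n : ℝ) ^ x) ^ i := by rw [mul_pow]
      _ ≤ _ := mul_le_mul_of_nonneg_left (pow_le_pow_left₀ (by positivity) hn.1 i) hc.le
  · exact Or.inr hG
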